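/- Setting. Let $\gamma\colon\mathbb R\to\mathbb R^2$ be a regular $C^3$ parameterization, with period $L>0$, of a simple closed plane curve $\Gamma=\gamma(\mathbb R)$ that is traversed exactly once over a period (that is, $\gamma$ is injective on $[0,L)$). Let $\kappa=\det(\gamma',\gamma'')/|\gamma'|^3$ be its signed curvature, $\dot\kappa=\kappa'/|\gamma'|$ the derivative of $\kappa$ with respect to arc length, $\sigma_\gamma(t)=(\kappa(t),\dot\kappa(t))$ the parameterized signature map, and $S_\Gamma=\sigma_\gamma(\mathbb R)\subset\mathbb R^2$ the signature. The curve is non-degenerate if its vertices, i.e. the points $\gamma(t)$ with $\dot\kappa(t)=0$, are isolated from one another. A point $p\in S_\Gamma$ is simple if some open set $U\ni p$ of $\mathbb R^2$ is such that $U\cap S_\Gamma$ is homeomorphic to $\mathbb R$ or to a half-open interval; otherwise $p$ is a point of self-intersection. Let $Q$ be the set of self-intersection points of $S_\Gamma$. If $Q$ is finite and non-empty, the signature quiver of $\Gamma$ has vertex set $Q$, and its edges are the connected components of $S_\Gamma\setminus Q$ (open curve segments), each directed from its beginning to its end point as traversed by $\sigma_\gamma$. Words are finite sequences of edges. Choose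 $c_0$ with $\sigma_\gamma(c_0)\in Q$ and let $c_0<c_1<\dots<c_k=c_0+L$ be all the points of $\sigma_\gamma^{-1}(Q)\cap[c_0,c_0+L]$. The word $S_1S_2\cdots S_k$, where $S_i=\sigma_\gamma\big((c_{i-1},c_i)\big)$ is an edge from $\sigma_\gamma(c_{i-1})$ to $\sigma_\gamma(c_i)$, is said to be induced by $\Gamma$. A word is periodic if it is of the form $v^n$ for some word $v$ and some $n>1$. The symmetry group $\mathrm{sym}(\Gamma)$ is the group of all $g\in SE(2)$ with $g\cdot\Gamma=\Gamma$, and $\text{sym-index}(\Gamma)$ is its cardinality. Proposition (Symmetry in terms of the signature quiver). Let $\Gamma$ be a simple closed non-degenerate curve as above whose signature has at least one, but only finitely many, points of self-intersection. If $\Gamma$ induces a word $W=w^m$ such that $w$ is not periodic, then $$\text{sym-index}(\Gamma)=m .$$ Hence $\mathrm{sym}(\Gamma)$ is the rotation group $\mathbb Z_m$: it is isomorphic to $\mathbb Z/m\mathbb Z$, and there is a point $C\in\mathbb R^2$ such that $\mathrm{sym}(\Gamma)$ consists exactly of the rotations about $C$ by the angles $2\pi k/m$, $0\le k<m$. -/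

import Mathlib

open Set

noncomputable section

/-- The Euclidean plane. -/
abbrev Plane : Type := EuclideanSpace ℝ (Fin 2)

/-! ### Symmetry groups -/

/-- The special Euclidean group of the plane: isometries whose linear part has determinant one. -/
def SE2 : Subgroup (Plane ≃ᵃⁱ[ℝ] Plane) where
  carrier := {g | LinearMap.det (g.linearIsometryEquiv.toLinearEquiv : Plane →ₗ[ℝ] Plane) = 1}
  one_mem' := by
    change LinearMap.det (LinearMap.id : Plane →ₗ[ℝ] Plane) = 1
    simp
  mul_mem' := by
    intro a b ha hb
    change LinearMap.det ((a.linearIsometryEquiv.toLinearEquiv : Plane →ₗ[ℝ] Plane) *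
      (b.linearIsometryEquiv.toLinearEquiv : Plane →ₗ[ℝ] Plane)) = 1
    rw [map_mul]
    exact (congrArg₂ (· * ·) ha hb).trans (one_mul 1)
  inv_mem' := by
    intro a ha
    have h : (a.linearIsometryEquiv.toLinearEquiv : Plane →ₗ[ℝ] Plane) *
        ((a⁻¹).linearIsometryEquiv.toLinearEquiv : Plane →ₗ[ℝ] Plane) = 1 := by
      ext1 x
      exact a.linearIsometryEquiv.apply_symm_apply x
    have h2 := congrArg LinearMap.det h
    rw [map_mul, map_one] at h2
    have h3 : LinearMap.det (a.linearIsometryEquiv.toLinearEquiv : Plane →ₗ[ℝ] Plane) = 1 := ha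
    rw [h3, one_mul] at h2
    exact h2

/-- The symmetry group of a subset `Γ` of the plane: the elements `g` of `SE(2)` with `g · Γ = Γ`. -/
def symGroup (Γ : Set Plane) : Subgroup SE2 where
  carrier := {g | (g : Plane ≃ᵃⁱ[ℝ] Plane) '' Γ = Γ}
  one_mem' := by
    change (id : Plane → Plane) '' Γ = Γ
    simp
  mul_mem' := by
    intro a b ha hb
    change (fun x => a.1 (b.1 x)) '' Γ = Γ
    rw [← Set.image_image (fun x => a.1 x) (fun x => b.1 x) Γ]
    exact (congrArg (fun s => a.1 '' s) hb).trans ha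
  inv_mem' := by
    intro a ha
    have ha' : a.1 '' Γ = Γ := ha
    change a.1.symm '' Γ = Γ
    conv_lhs => rw [← ha']
    rw [Set.image_image]
    simp

/-- The (global) symmetry index: the cardinality of the symmetry group. -/
def symIndex (Γ : Set Plane) : ℕ∞ := ENat.card (symGroup Γ)

/-- Counterclockwise rotation about the point `C` by the angle `θ`. -/
def rotationAbout (C : Plane) (θ : ℝ) (x : Plane) : Plane :=
  !₂[C 0 + Real.cos θ * (x 0 - C 0) - Real.sin θ * (x 1 - C 1),
     C 1 + Real.sin θ * (x 0 - C 0) + Real.cos θ * (x 1 - C 1)]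

/-! ### Curves, curvature, signature -/

/-- `γ` is a regular `C³` parameterization (over all of `ℝ`) of a simple closed curve, with
period `L`, the curve being traversed exactly once over a period. -/
structure IsSimpleClosed (γ : ℝ → Plane) (L : ℝ) : Prop where
  contDiff : ContDiff ℝ 3 γ
  regular : ∀ t, deriv γ t ≠ 0
  period_pos : 0 < L
  periodic : Function.Periodic γ L
  injOn : Set.InjOn γ (Set.Ico 0 L)

/-- The signed Euclidean curvature `det(γ', γ'') / |γ'|³`. -/
def curvature (γ : ℝ → Plane) (t : ℝ) : ℝ :=
  (deriv γ t 0 * deriv (deriv γ) t 1 - deriv γ t 1 * deriv (deriv γ) t 0) / ‖deriv γ t‖ ^ 3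

/-- The derivative of the curvature with respect to arc length, `dκ/ds = κ'(t) / |γ'(t)|`. -/
def curvatureDot (γ : ℝ → Plane) (t : ℝ) : ℝ :=
  deriv (curvature γ) t / ‖deriv γ t‖

/-- The parameterized signature map `t ↦ (κ, dκ/ds)`; its range is the signature. -/
def sigMap (γ : ℝ → Plane) (t : ℝ) : ℝ × ℝ :=
  (curvature γ t, curvatureDot γ t)

/-- The vertices of the curve parameterized by `γ`: the points where `dκ/ds = 0`. -/
def curveVertices (γ : ℝ → Plane) : Set Plane :=
  γ '' {t | curvatureDot γ t = 0}

/-- A curve is non-degenerate if each of its vertices is isolated, i.e. has a neighbourhood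
that contains no other vertex. -/
def IsNondegenerate (γ : ℝ → Plane) : Prop :=
  ∀ p ∈ curveVertices γ, ∃ U : Set Plane, IsOpen U ∧ U ∩ curveVertices γ = {p}

/-! ### Self-intersections and the signature quiver -/

/-- `p` is a simple point of `S`: some open neighbourhood of `p` meets `S` in a set homeomorphic
to `ℝ` or to a half-open interval. -/
def IsSimplePoint {X : Type*} [TopologicalSpace X] (S : Set X) (p : X) : Prop :=
  ∃ U : Set X, IsOpen U ∧ p ∈ U ∧
    (Nonempty (↥(U ∩ S) ≃ₜ ℝ) ∨ Nonempty (↥(U ∩ S) ≃ₜ ↥(Set.Ico (0 : ℝ) 1)))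

/-- The set of points of self-intersection of `S`. -/
def selfIntersections {X : Type*} [TopologicalSpace X] (S : Set X) : Set X :=
  {p | p ∈ S ∧ ¬ IsSimplePoint S p}

/-- The open segments of the curve `S` left after removing the points of self-intersection,
i.e. the connected components of the rest. -/
def openSegments {X : Type*} [TopologicalSpace X] (S : Set X) : Set (Set X) :=
  {E | ∃ x ∈ S \ selfIntersections S, E = connectedComponentIn (S \ selfIntersections S) x}

/-- The vertices of the quiver of the curve parameterized by `σ`: its self-intersection points. -/
def QuiverVertex (σ : ℝ → ℝ × ℝ) : Type :=
  ↥(selfIntersections (Set.range σ))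

/-- The quiver of the oriented closed curve parameterized by `σ`. The edges from `q` to `q'` are
the open segments of the curve which `σ` traverses in its direction from `q` to `q'`. -/
instance signatureQuiver (σ : ℝ → ℝ × ℝ) : Quiver (QuiverVertex σ) where
  Hom q q' := {E : Set (ℝ × ℝ) // E ∈ openSegments (Set.range σ) ∧
    ∃ a b : ℝ, a < b ∧ σ a = q.1 ∧ σ b = q'.1 ∧ σ '' Set.Ioo a b = E}

/-- Edges of the quiver, with their end points. -/
abbrev QuiverEdge (σ : ℝ → ℝ × ℝ) : Type := Quiver.Total (QuiverVertex σ)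

/-- The word `w ^ m`. -/
def wordPow {A : Type*} (w : List A) (m : ℕ) : List A := (List.replicate m w).flatten

/-- A word is periodic if it is a power `v ^ n` with `n > 1`. -/
def IsPeriodicWord {A : Type*} (w : List A) : Prop :=
  ∃ (v : List A) (n : ℕ), 1 < n ∧ w = wordPow v n

/-- The closed curve `γ` with period `L` induces the word `W` on its signature quiver: starting at
a parameter `c₀` which the signature map `σ` sends to a self-intersection point, let
`c₀ < c₁ < ⋯ < c_k = c₀ + L` be all the parameters in `[c₀, c₀ + L]` sent to self-intersection
points; then the `i`-th letter of `W` is the edge `σ((c_i, c_{i+1}))` from `σ(c_i)` to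
`σ(c_{i+1})`, for `0 ≤ i < k`. -/
def InducesWord (γ : ℝ → Plane) (L : ℝ) (W : List (QuiverEdge (sigMap γ))) : Prop :=
  ∃ c : Fin (W.length + 1) → ℝ,
    StrictMono c ∧
    c (Fin.last W.length) = c 0 + L ∧
    Set.range c =
      Set.Icc (c 0) (c 0 + L) ∩ sigMap γ ⁻¹' selfIntersections (Set.range (sigMap γ)) ∧
    ∀ i : Fin W.length,
      (W.get i).left.1 = sigMap γ (c i.castSucc) ∧
      (W.get i).right.1 = sigMap γ (c i.succ) ∧
      (W.get i).hom.1 = sigMap γ '' Set.Ioo (c i.castSucc) (c i.succ)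

end

open Filter Topology

/-! ### Continuous functions of a real variable -/

/-! Parametrize Γ by arc length as a curve `z` in ℂ of length ℓ and put σ = (κ, κ'). An element of
SE(2) acts by x ↦ u x + v with |u| = 1. If it preserves Γ, it shifts the arc length parameter
(`exists_shift_of_isometry`), and the shift is then a period of σ (`signature_shift`). Conversely
every period of σ comes from such a motion, because the curvature determines the curve
(`exists_isometry_of_shift`). So sym(Γ) is the group of periods of σ modulo ℓ, and the point is to
show that the least positive period P satisfies mP = ℓ.

The word decides the periods. The second coordinate of σ is the derivative of the first, so wherever
it is nonzero the position on the signature dictates the speed. Hence two passages of σ through a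
simple point differ, near it, by a translation of the parameter; the zeros of κ' are isolated, and
continuity bridges them (`IsSimplePoint.eventually_eq_shift`). Propagated along an edge, this says
that two traversals of one edge have equal length and agree up to translation (`gap_translate`). So
the length P of one block w is a period of σ, and m blocks make up ℓ. Any other period permutes the
parameters of self-intersection points and rotates the cyclic word, necessarily by a multiple of the
length of w because w is not periodic (`length_dvd_of_shift_invariant`). This is
`exists_minimal_period`.

The motion that realizes the shift by P generates the symmetries. Since its powers first fix the
curve pointwise after m steps, it is a rotation of order m (`exists_primitive_rotation`). -/

theorem IsPreconnected.eqOn_of_eventually_eq {X Y : Type*} [TopologicalSpace X]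
    [TopologicalSpace Y] [T2Space Y] {s : Set X} (hs : IsPreconnected s) {f g : X → Y}
    (hf : Continuous f) (hg : Continuous g)
    (hloc : ∀ x ∈ s, f x = g x → ∀ᶠ y in 𝓝 x, f y = g y)
    {x₀ : X} (hx₀ : x₀ ∈ s) (h₀ : f x₀ = g x₀) : EqOn f g s := by
  have key : s ⊆ interior {x | f x = g x} := by
    refine hs.subset_of_closure_inter_subset isOpen_interior
      ⟨x₀, hx₀, mem_interior_iff_mem_nhds.2 (hloc x₀ hx₀ h₀)⟩ ?_
    rintro x ⟨hx, hxs⟩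
    have hx' : x ∈ {x | f x = g x} :=
      (isClosed_eq hf hg).closure_subset_iff.2 interior_subset hx
    exact mem_interior_iff_mem_nhds.2 (hloc x hxs hx')
  exact fun x hx => interior_subset (s := {x | f x = g x}) (key hx)

/-- A continuous injection of a compact set into a Hausdorff space is a closed embedding, so lifting
through it preserves continuity. -/
theorem exists_continuousOn_lift {X Y V : Type*} [TopologicalSpace X] [TopologicalSpace Y]
    [T2Space Y] [TopologicalSpace V] [Nonempty X] {F : X → Y} {G : V → Y} {K : Set X} {s : Set V}
    (hK : IsCompact K) (hF : ContinuousOn F K) (hinj : InjOn F K) (hG : ContinuousOn G s)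
    (h : ∀ v ∈ s, G v ∈ F '' K) :
    ∃ ψ : V → X, ContinuousOn ψ s ∧ ∀ v ∈ s, ψ v ∈ K ∧ F (ψ v) = G v := by
  classical
  have : CompactSpace K := isCompact_iff_compactSpace.1 hK
  have hemb : Topology.IsClosedEmbedding (K.domRestrict F) :=
    (continuousOn_iff_continuous_domRestrict.1 hF).isClosedEmbedding (injOn_iff_injective.1 hinj)
  choose! ψ hψ using h
  refine ⟨ψ, ?_, hψ⟩
  rw [continuousOn_iff_continuous_domRestrict] at hG ⊢
  have hc : Continuous (fun v : s => (⟨ψ v, (hψ v v.2).1⟩ : K)) := by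
    rw [hemb.isInducing.continuous_iff]
    convert hG using 1
    ext v
    exact (hψ v v.2).2
  exact continuous_subtype_val.comp hc

/-- Near `s`, the continuous `ψ` must be the local inverse of `f` composed with `g`; this upgrades a
merely continuous lift to a differentiable one. -/
theorem hasDerivAt_of_comp_eventuallyEq {f g ψ : ℝ → ℝ} {f' g' s : ℝ}
    (hf : HasStrictDerivAt f f' (ψ s)) (hf' : f' ≠ 0) (hg : HasDerivAt g g' s)
    (hψ : ContinuousAt ψ s) (h : ∀ᶠ u in 𝓝 s, f (ψ u) = g u) :
    HasDerivAt ψ (f'⁻¹ * g') s := by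
  have hs : f (ψ s) = g s := h.self_of_nhds
  have hinv := hf.to_localInverse hf'
  have h1 : ∀ᶠ u in 𝓝 s, ψ u = hf.localInverse f f' (ψ s) hf' (g u) := by
    have := hψ.eventually
      ((hf.hasStrictFDerivAt_equiv hf').eventually_left_inverse)
    filter_upwards [this, h] with u hu hu2
    rw [← hu2]
    exact hu.symm
  rw [hs] at hinv
  exact (hinv.hasDerivAt.comp s hg).congr_of_eventuallyEq h1

/-- The mean value theorem on either side of the centre needs only continuity there. This is what
lets an isolated vertex be crossed. -/
theorem eq_add_mul_of_hasDerivAt_ne {ψ : ℝ → ℝ} {c t r : ℝ}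
    (hψ : ContinuousOn ψ (Metric.ball t r))
    (hd : ∀ s ∈ Metric.ball t r, s ≠ t → HasDerivAt ψ c s) :
    ∀ s ∈ Metric.ball t r, ψ s = ψ t + c * (s - t) := by
  intro s hs
  have ht : t ∈ Metric.ball t r := Metric.mem_ball_self (Metric.pos_of_mem_ball hs)
  have hord : OrdConnected (Metric.ball t r) := by
    rw [Real.ball_eq_Ioo]; exact ordConnected_Ioo
  rcases lt_trichotomy s t with hst | rfl | hst
  · obtain ⟨x, hx, h⟩ := exists_hasDerivAt_eq_slope ψ (fun _ => c) hst
      (hψ.mono (hord.out hs ht))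
      (fun x hx => hd x (hord.out hs ht (Ioo_subset_Icc_self hx)) hx.2.ne)
    rw [eq_div_iff (by linarith)] at h
    linarith
  · simp
  · obtain ⟨x, hx, h⟩ := exists_hasDerivAt_eq_slope ψ (fun _ => c) hst
      (hψ.mono (hord.out ht hs))
      (fun x hx => hd x (hord.out ht hs (Ioo_subset_Icc_self hx)) hx.1.ne')
    rw [eq_div_iff (by linarith)] at h
    linarith

/-- A continuous injection of an interval is strictly monotone, so the intermediate value theorem
applies between the end values. -/
theorem ContinuousOn.image_Icc_mem_nhds_of_injOn {f : ℝ → ℝ} {t r : ℝ} (hr : 0 < r)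
    (hf : ContinuousOn f (Icc (t - r) (t + r))) (hinj : InjOn f (Icc (t - r) (t + r))) :
    f '' Icc (t - r) (t + r) ∈ 𝓝 (f t) := by
  have h1 : t - r ∈ Icc (t - r) (t + r) := ⟨le_rfl, by linarith⟩
  have h2 : t ∈ Icc (t - r) (t + r) := ⟨by linarith, by linarith⟩
  have h3 : t + r ∈ Icc (t - r) (t + r) := ⟨by linarith, le_rfl⟩
  rcases hf.strictMonoOn_of_injOn_Icc' (by linarith) hinj with hm | hm
  · exact mem_of_superset (Icc_mem_nhds (hm h1 h2 (by linarith)) (hm h2 h3 (by linarith)))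
      (intermediate_value_Icc (by linarith) hf)
  · exact mem_of_superset (Icc_mem_nhds (hm h2 h3 (by linarith)) (hm h1 h2 (by linarith)))
      (intermediate_value_Icc' (by linarith) hf)

/-! ### The signature near a simple point. -/

/-- Of simplicity, only a continuous injective coordinate with values in ℝ is kept, which treats
interior points and end points of the signature alike. -/
theorem IsSimplePoint.exists_injOn_real {X : Type*} [TopologicalSpace X] {S : Set X} {p : X}
    (h : IsSimplePoint S p) : ∃ (U : Set X) (H : X → ℝ), IsOpen U ∧ p ∈ U ∧
      ContinuousOn H (U ∩ S) ∧ InjOn H (U ∩ S) := by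
  classical
  obtain ⟨U, hU, hp, h⟩ := h
  obtain ⟨k, hk, hki⟩ : ∃ k : ↥(U ∩ S) → ℝ, Continuous k ∧ Function.Injective k := by
    rcases h with ⟨⟨k⟩⟩ | ⟨⟨k⟩⟩
    · exact ⟨k, k.continuous, k.injective⟩
    · exact ⟨fun x => k x, continuous_subtype_val.comp k.continuous,
        Subtype.val_injective.comp k.injective⟩
  have hr : (U ∩ S).domRestrict (fun x => if hx : x ∈ U ∩ S then k ⟨x, hx⟩ else 0) = k := by
    ext x
    exact dif_pos x.2
  refine ⟨U, fun x => if hx : x ∈ U ∩ S then k ⟨x, hx⟩ else 0, hU, hp, ?_, ?_⟩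
  · rw [continuousOn_iff_continuous_domRestrict, hr]
    exact hk
  · rw [injOn_iff_injective, hr]
    exact hki

/-- If the zeros of `f'` are isolated then `t ↦ (f t, f' t)` is locally injective. -/
theorem exists_injOn_prodMk_deriv {f f' : ℝ → ℝ} (hf : ∀ s, HasDerivAt f (f' s) s) (t : ℝ)
    (hiso : ∀ᶠ u in 𝓝[≠] t, f' u ≠ 0) :
    ∃ r > 0, InjOn (fun s => (f s, f' s)) (Metric.ball t r) := by
  rw [eventually_nhdsWithin_iff, Metric.eventually_nhds_iff_ball] at hiso
  obtain ⟨r, hr, h⟩ := hiso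
  refine ⟨r, hr, ?_⟩
  have hord : OrdConnected (Metric.ball t r) := by
    rw [Real.ball_eq_Ioo]; exact ordConnected_Ioo
  have hcont : Continuous f := continuous_iff_continuousAt.2 fun s => (hf s).continuousAt
  have main : ∀ u ∈ Metric.ball t r, ∀ v ∈ Metric.ball t r, u < v →
      f u = f v → f' u = f' v → False := by
    intro u hu v hv huv h1 h2
    have hmem : ∀ x ∈ Icc u v, x ≠ t → f' x ≠ 0 := fun x hx hxt => h x (hord.out hu hv hx) hxt
    -- By Rolle `f'` vanishes between `u` and `v`, hence at the centre. By Darboux `f'` has a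
    -- constant sign on each side of it: equal signs contradict `f u = f v`, opposite signs
    -- contradict `f' u = f' v`.
    obtain ⟨x, hx, hx0⟩ := exists_hasDerivAt_eq_zero huv hcont.continuousOn h1
      (fun x _ => hf x)
    have hxt : x = t := by
      by_contra hne
      exact hmem x (Ioo_subset_Icc_self hx) hne hx0
    subst hxt
    have hl := hasDerivWithinAt_forall_lt_or_forall_gt_of_forall_ne (convex_Ico u x)
      (fun y _ => (hf y).hasDerivWithinAt) (m := 0)
      (fun y hy => hmem y ⟨hy.1, hy.2.le.trans hx.2.le⟩ hy.2.ne)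
    have hrr := hasDerivWithinAt_forall_lt_or_forall_gt_of_forall_ne (convex_Ioc x v)
      (fun y _ => (hf y).hasDerivWithinAt) (m := 0)
      (fun y hy => hmem y ⟨hx.1.le.trans hy.1.le, hy.2⟩ hy.1.ne')
    have hul : u ∈ Ico u x := ⟨le_rfl, hx.1⟩
    have hvr : v ∈ Ioc x v := ⟨hx.2, le_rfl⟩
    obtain ⟨y, hy, hys⟩ := exists_hasDerivAt_eq_slope f f' hx.1 hcont.continuousOn
      (fun y _ => hf y)
    obtain ⟨y', hy', hys'⟩ := exists_hasDerivAt_eq_slope f f' hx.2 hcont.continuousOn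
      (fun y _ => hf y)
    rw [eq_div_iff (by linarith [hx.1])] at hys
    rw [eq_div_iff (by linarith [hx.2])] at hys'
    have e1 : y ∈ Ico u x := Ioo_subset_Ico_self hy
    have e2 : y' ∈ Ioc x v := Ioo_subset_Ioc_self hy'
    have p1 : 0 < x - u := by linarith [hx.1]
    have p2 : 0 < v - x := by linarith [hx.2]
    rcases hl with hl | hl <;> rcases hrr with hrr | hrr
    · have := mul_neg_of_neg_of_pos (hl y e1) p1
      have := mul_neg_of_neg_of_pos (hrr y' e2) p2
      linarith
    · linarith [hl u hul, hrr v hvr]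
    · linarith [hl u hul, hrr v hvr]
    · have := mul_pos (hl y e1) p1
      have := mul_pos (hrr y' e2) p2
      linarith
  intro u hu v hv huv
  simp only [Prod.mk.injEq] at huv
  rcases lt_trichotomy u v with hlt | heq | hlt
  · exact (main u hu v hv hlt huv.1 huv.2).elim
  · exact heq
  · exact (main v hv u hu hlt huv.1.symm huv.2.symm).elim

/-- At a simple point of its signature, a curve with isolated vertices is determined, up to a
translation of the arc length parameter. -/
theorem IsSimplePoint.eventually_eq_shift {f f' : ℝ → ℝ} (hf : ∀ s, HasDerivAt f (f' s) s)
    (hf' : Continuous f') (hiso : ∀ t, ∀ᶠ u in 𝓝[≠] t, f' u ≠ 0) {t t' : ℝ}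
    (hp : IsSimplePoint (range fun s => (f s, f' s)) (f t, f' t))
    (ht : (f t, f' t) = (f t', f' t')) :
    ∀ᶠ s in 𝓝 t, (f s, f' s) = (f (s + (t' - t)), f' (s + (t' - t))) := by
  have hcf : Continuous f := continuous_iff_continuousAt.2 fun s => (hf s).continuousAt
  set σ : ℝ → ℝ × ℝ := fun s => (f s, f' s) with hσ
  have hcσ : Continuous σ := hcf.prodMk hf'
  obtain ⟨U, H, hU, hpU, hH, hHi⟩ := hp.exists_injOn_real
  have hpU' : σ t' ∈ U := by
    change (f t', f' t') ∈ U
    rwa [← ht]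
  obtain ⟨r, hr, hinj⟩ := exists_injOn_prodMk_deriv hf t' (hiso t')
  obtain ⟨r', hr', hrU⟩ := Metric.mem_nhds_iff.1 (hcσ.continuousAt.preimage_mem_nhds
    (hU.mem_nhds hpU'))
  obtain ⟨ε, hε, hεr⟩ := exists_between (lt_min hr hr')
  set K := Icc (t' - ε) (t' + ε) with hK
  have hKr : ∀ x ∈ K, x ∈ Metric.ball t' r ∧ σ x ∈ U := by
    intro x hx
    have hd : dist x t' ≤ ε := by
      rw [← Real.closedBall_eq_Icc] at hK
      exact Metric.mem_closedBall.1 (hK ▸ hx)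
    exact ⟨hd.trans_lt (hεr.trans_le (min_le_left _ _)),
      hrU (hd.trans_lt (hεr.trans_le (min_le_right _ _)))⟩
  have hinjK : InjOn σ K := fun x hx y hy hxy => hinj (hKr x hx).1 (hKr y hy).1 hxy
  have hmaps : MapsTo σ K (U ∩ range σ) := fun x hx => ⟨(hKr x hx).2, mem_range_self x⟩
  -- In the coordinate `H`, the short arc of `σ` around `t'` covers a neighbourhood of its centre,
  -- so it captures `σ s` for every `s` near `t`.
  have hnhds := ContinuousOn.image_Icc_mem_nhds_of_injOn hε
    (hH.comp hcσ.continuousOn hmaps) (hHi.comp hinjK hmaps)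
  have hev : ∀ᶠ s in 𝓝 t, σ s ∈ σ '' K := by
    have hUt : ∀ᶠ s in 𝓝 t, σ s ∈ U := hcσ.continuousAt.eventually (hU.mem_nhds hpU)
    have hHσ : ContinuousAt (H ∘ σ) t := by
      have h1 : ContinuousWithinAt H (U ∩ range σ) (σ t) := hH _ ⟨hpU, mem_range_self t⟩
      have h2 : Tendsto σ (𝓝 t) (𝓝[U ∩ range σ] (σ t)) :=
        tendsto_nhdsWithin_iff.2 ⟨hcσ.continuousAt, hUt.mono fun s hs => ⟨hs, mem_range_self s⟩⟩
      exact h1.tendsto.comp h2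
    have h3 : (H ∘ σ) t = (H ∘ σ) t' := congrArg H ht
    rw [← h3] at hnhds
    filter_upwards [hUt, hHσ.eventually hnhds] with s hs ⟨x, hx, hxs⟩
    exact ⟨x, hx, hHi (hmaps hx) ⟨hs, mem_range_self s⟩ hxs⟩
  have hiso' := hiso t
  rw [eventually_nhdsWithin_iff] at hiso'
  obtain ⟨ρ, hρ, hball⟩ := Metric.eventually_nhds_iff_ball.1 (hev.and hiso')
  obtain ⟨ψ, hψ, hψK⟩ := exists_continuousOn_lift isCompact_Icc hcσ.continuousOn hinjK
    (hcσ.continuousOn (s := Metric.ball t ρ)) (fun s hs => (hball s hs).1)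
  have htρ := Metric.mem_ball_self (x := t) hρ
  have hψt : ψ t = t' := hinjK (hψK t htρ).1 ⟨by linarith, by linarith⟩ ((hψK t htρ).2.trans ht)
  -- Differentiating `f (ψ s) = f s` gives `f' (ψ s) * ψ' = f' s`. Here `f' (ψ s) = f' s` is nonzero
  -- off `t`, so `ψ` has slope 1.
  have hlin := eq_add_mul_of_hasDerivAt_ne (c := 1) hψ (fun s hs hst => by
    have hne := (hball s hs).2 hst
    have e : ∀ᶠ u in 𝓝 s, f (ψ u) = f u := by
      filter_upwards [Metric.isOpen_ball.mem_nhds hs] with u hu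
      exact congrArg Prod.fst (hψK u hu).2
    have e' : f' (ψ s) = f' s := congrArg Prod.snd (hψK s hs).2
    have hd := hasDerivAt_of_comp_eventuallyEq (ψ := ψ)
      (hasStrictDerivAt_of_hasDerivAt_of_continuousAt (Eventually.of_forall hf)
        hf'.continuousAt) (e' ▸ hne) (hf s) (hψ.continuousAt (Metric.isOpen_ball.mem_nhds hs)) e
    rwa [e', inv_mul_cancel₀ hne] at hd)
  filter_upwards [Metric.ball_mem_nhds t hρ] with s hs
  have h1 := (hψK s hs).2
  rw [hlin s hs, hψt] at h1
  have h2 : t' + 1 * (s - t) = s + (t' - t) := by ring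
  rw [h2] at h1
  exact h1.symm

/-- Choose parameters in both gaps with the same image and extend the local translation by
connectedness over the common part of one gap and the translate of the other. If the ends did not
match, an end of one gap, where σ is not simple, would have the same image as an interior point of
the other. -/
theorem gap_translate {f f' : ℝ → ℝ} (hf : ∀ s, HasDerivAt f (f' s) s)
    (hf' : Continuous f') (hiso : ∀ t, ∀ᶠ u in 𝓝[≠] t, f' u ≠ 0) {σ : ℝ → ℝ × ℝ}
    (hσ : σ = fun s => (f s, f' s)) {a b a' b' : ℝ} (hab : a < b)
    (ha : ¬ IsSimplePoint (range σ) (σ a)) (hb : ¬ IsSimplePoint (range σ) (σ b))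
    (ha' : ¬ IsSimplePoint (range σ) (σ a')) (hb' : ¬ IsSimplePoint (range σ) (σ b'))
    (h : ∀ x ∈ Ioo a b, IsSimplePoint (range σ) (σ x))
    (h' : ∀ x ∈ Ioo a' b', IsSimplePoint (range σ) (σ x))
    (him : σ '' Ioo a b = σ '' Ioo a' b') :
    b' - a' = b - a ∧ ∀ x ∈ Icc a b, σ x = σ (x + (a' - a)) := by
  have hcσ : Continuous σ := by
    rw [hσ]
    exact (continuous_iff_continuousAt.2 fun s => (hf s).continuousAt).prodMk hf'
  obtain ⟨t, ht⟩ := nonempty_Ioo.2 hab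
  obtain ⟨t', ht', htt'⟩ := him ▸ mem_image_of_mem σ ht
  set δ := t' - t with hδ
  have hg : Continuous fun x => σ (x + δ) := hcσ.comp (continuous_add_const δ)
  set α := max a (a' - δ) with hα
  set β := min b (b' - δ) with hβ
  have hαt : α < t := max_lt ht.1 (by linarith [ht'.1])
  have htβ : t < β := lt_min ht.2 (by linarith [ht'.2])
  have hEq : EqOn σ (fun x => σ (x + δ)) (Ioo α β) := by
    refine isPreconnected_Ioo.eqOn_of_eventually_eq hcσ hg ?_ ⟨hαt, htβ⟩
      (htt'.symm.trans (by simp [hδ]))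
    intro x hx hxx
    have hsx := h x ⟨(le_max_left _ _).trans_lt hx.1, hx.2.trans_le (min_le_left _ _)⟩
    subst hσ
    have := hsx.eventually_eq_shift hf hf' hiso hxx
    simpa only [add_sub_cancel_left] using this
  have hEqc : EqOn σ (fun x => σ (x + δ)) (Icc α β) := by
    rw [← closure_Ioo (hαt.trans htβ).ne]
    exact hEq.closure hcσ hg
  have h1 := hEqc (left_mem_Icc.2 (hαt.trans htβ).le)
  have h2 := hEqc (right_mem_Icc.2 (hαt.trans htβ).le)
  have hα1 : a = a' - δ := by
    rcases lt_trichotomy a (a' - δ) with hlt | heq | hlt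
    · have e : α = a' - δ := max_eq_right hlt.le
      rw [e] at h1 hαt
      simp only [sub_add_cancel] at h1
      exact (ha' (h1 ▸ h _ ⟨hlt, hαt.trans ht.2⟩)).elim
    · exact heq
    · have e : α = a := max_eq_left hlt.le
      rw [e] at h1
      exact (ha (h1 ▸ h' _ ⟨by linarith, by linarith [ht.1, ht'.2]⟩)).elim
  have hβ1 : b = b' - δ := by
    rcases lt_trichotomy b (b' - δ) with hlt | heq | hlt
    · have e : β = b := min_eq_left hlt.le
      rw [e] at h2
      exact (hb (h2 ▸ h' _ ⟨by linarith [ht.2, ht'.1], by linarith⟩)).elim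
    · exact heq
    · have e : β = b' - δ := min_eq_right hlt.le
      rw [e] at h2 htβ
      simp only [sub_add_cancel] at h2
      exact (hb' (h2 ▸ h _ ⟨ht.1.trans htβ, hlt⟩)).elim
  have e1 : a' - a = δ := by linarith
  have e2 : α = a := by rw [hα, ← hα1, max_self]
  have e3 : β = b := by rw [hβ, ← hβ1, min_self]
  rw [e2, e3] at hEqc
  exact ⟨by linarith, fun x hx => by rw [e1]; exact hEqc hx⟩

/-! ### Words -/

theorem wordPow_length {A : Type*} (w : List A) (m : ℕ) :
    (wordPow w m).length = m * w.length := by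
  simp [wordPow]

theorem wordPow_getElem {A : Type*} (w : List A) (m i : ℕ) (h : i < (wordPow w m).length)
    (h' : i % w.length < w.length) : (wordPow w m)[i] = w[i % w.length] := by
  induction m generalizing i with
  | zero => simp [wordPow] at h
  | succ m ih =>
    have e : wordPow w (m + 1) = w ++ wordPow w m := by simp [wordPow, List.replicate_succ]
    simp only [e, List.getElem_append]
    split_ifs with hi
    · simp only [Nat.mod_eq_of_lt hi]
    · push Not at hi
      have h1 : (i - w.length) % w.length = i % w.length := (Nat.mod_eq_sub_mod hi).symm
      rw [ih (i - w.length) _ (by rwa [h1])]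
      simp only [h1]

/-- If the cyclic word `w` is invariant under the rotation by `j` and `w` is not periodic then the
length of `w` divides `j`. -/
theorem length_dvd_of_shift_invariant {A : Type*} {w : List A} (hw : ¬ IsPeriodicWord w)
    {e : ℕ → A} (he : ∀ i (h : i < w.length), e i = w[i])
    (hper : ∀ i, e (i + w.length) = e i) {j : ℕ} (hj : ∀ i, e (i + j) = e i) :
    w.length ∣ j := by
  by_contra hdvd
  have hn : 0 < w.length := by
    rw [List.length_pos_iff]
    rintro rfl
    exact hw ⟨[], 2, one_lt_two, rfl⟩
  set n := w.length with hn_def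
  set d := Nat.gcd j n with hd_def
  have hdn : d ∣ n := Nat.gcd_dvd_right j n
  have hd0 : 0 < d := Nat.gcd_pos_of_pos_right j hn
  have hdlt : d < n := by
    refine lt_of_le_of_ne (Nat.le_of_dvd hn hdn) fun h => hdvd ?_
    rw [← h]
    exact Nat.gcd_dvd_left j n
  have mulper : ∀ p, (∀ i, e (i + p) = e i) → ∀ q i, e (i + q * p) = e i := by
    intro p hp q
    induction q with
    | zero => simp
    | succ q ih =>
      intro i
      rw [add_mul, one_mul, ← add_assoc, hp, ih]
  -- By Bézout, the periods `j` and `n` make their gcd `d` a period of the letters; as `d < n`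
  -- divides `n`, the word is a proper power of its first `d` letters.
  obtain ⟨x, -, hx⟩ := Nat.exists_mul_mod_eq_gcd hdlt
  have hde : ∀ i, e (i + d) = e i := by
    intro i
    rw [← mulper n hper (j * x / n) (i + d), ← mulper j hj x i]
    congr 1
    have := Nat.mod_add_div (j * x) n
    rw [hx] at this
    rw [add_assoc, mul_comm (j * x / n), this, mul_comm x]
  have hmod : ∀ i, e i = e (i % d) := by
    intro i
    conv_lhs => rw [← Nat.mod_add_div i d, mul_comm d]
    exact mulper d hde _ _
  have hl : (w.take d).length = d := by rw [List.length_take]; omega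
  refine hw ⟨w.take d, n / d, ?_, ?_⟩
  · obtain ⟨q, hq⟩ := hdn
    rw [hq, Nat.mul_div_cancel_left _ hd0]
    by_contra hq1
    have : q = 0 ∨ q = 1 := by omega
    rcases this with rfl | rfl <;> simp at hq <;> omega
  · refine List.ext_getElem ?_ fun i h1 h2 => ?_
    · rw [wordPow_length, hl, Nat.div_mul_cancel hdn]
    · rw [wordPow_getElem _ _ _ _ (by rw [hl]; exact Nat.mod_lt _ hd0), List.getElem_take,
        ← he i h1, hmod]
      simp only [hl]
      exact he _ _

/-! ### The cyclic sequence of parameters of self-intersection points -/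

/-- The parameters in one period are extended to a sequence that enumerates all later parameters,
and so are the labels of the gaps between them. -/
theorem exists_periodic_extension {B : Type*} {k : ℕ} {c : Fin (k + 1) → ℝ} {ℓ : ℝ} (hℓ : 0 < ℓ)
    (hc : StrictMono c) (hlast : c (Fin.last k) = c 0 + ℓ) {Z : Set ℝ}
    (hZ : ∀ t, t + ℓ ∈ Z ↔ t ∈ Z) (hrange : range c = Icc (c 0) (c 0 + ℓ) ∩ Z)
    {lab : Fin k → B} {Λ : ℝ → ℝ → B} (hΛ : ∀ s t, Λ (s + ℓ) (t + ℓ) = Λ s t)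
    (hlab : ∀ i : Fin k, lab i = Λ (c i.castSucc) (c i.succ)) :
    ∃ C : ℕ → ℝ, StrictMono C ∧ (∀ i, C (i + k) = C i + ℓ) ∧ (∀ i, C i ∈ Z) ∧
      (∀ t ∈ Z, C 0 ≤ t → ∃ i, C i = t) ∧
      ∀ i (h : i % k < k), lab ⟨i % k, h⟩ = Λ (C i) (C (i + 1)) := by
  have hk : 0 < k := by
    rcases Nat.eq_zero_or_pos k with rfl | h
    · have : c (Fin.last 0) = c 0 := rfl
      linarith
    · exact h
  have hmod : ∀ i, i % k < k := fun i => Nat.mod_lt i hk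
  have hZn : ∀ (q : ℕ) t, t + q * ℓ ∈ Z ↔ t ∈ Z := by
    intro q t
    induction q with
    | zero => simp
    | succ q ih => rw [← ih, ← hZ (t + q * ℓ)]; push_cast; ring_nf
  have hΛn : ∀ (q : ℕ) s t, Λ (s + q * ℓ) (t + q * ℓ) = Λ s t := by
    intro q s t
    induction q with
    | zero => simp
    | succ q ih => rw [← ih, ← hΛ (s + q * ℓ)]; push_cast; ring_nf
  set C : ℕ → ℝ := fun i => c (Fin.castSucc ⟨i % k, hmod i⟩) + (i / k : ℕ) * ℓ with hC
  -- When `i + 1` wraps around to a new period, the last of the `k + 1` given parameters replaces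
  -- the first one, since they differ by `ℓ`.
  have hCs : ∀ i, C (i + 1) = c (Fin.succ ⟨i % k, hmod i⟩) + (i / k : ℕ) * ℓ := by
    intro i
    by_cases hi : i % k + 1 < k
    · obtain ⟨h2, h1⟩ := (Nat.div_mod_unique (a := i + 1) (c := i % k + 1) (d := i / k) hk).2
        ⟨by rw [add_right_comm, Nat.mod_add_div], hi⟩
      simp only [hC, h2]
      congr 2
      ext
      simp [h1]
    · have h0 : i + 1 = k * (i / k + 1) := by
        have := Nat.mod_add_div i k
        have := hmod i
        rw [mul_add, mul_one]
        omega
      have h1 : (i + 1) % k = 0 := by rw [h0, Nat.mul_mod_right]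
      have h2 : (i + 1) / k = i / k + 1 := by rw [h0, Nat.mul_div_cancel_left _ hk]
      have e1 : Fin.castSucc (⟨(i + 1) % k, hmod _⟩ : Fin k) = 0 := by ext; simp [h1]
      have e2 : Fin.succ (⟨i % k, hmod _⟩ : Fin k) = Fin.last k := by
        ext
        have := hmod i
        simp only [Fin.val_succ, Fin.val_last]
        omega
      simp only [hC, h2, e1, e2, hlast]
      push_cast
      ring
  refine ⟨C, strictMono_nat_of_lt_succ fun i => ?_, fun i => ?_, fun i => ?_, fun t ht h0 => ?_,
    fun i h => ?_⟩
  · rw [hCs]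
    simp only [hC]
    gcongr
    exact hc Fin.castSucc_lt_succ
  · simp only [hC, Nat.add_mod_right, Nat.add_div_right _ hk]
    push_cast
    ring
  · simp only [hC, hZn]
    exact (hrange ▸ mem_range_self _ : _ ∈ Icc (c 0) (c 0 + ℓ) ∩ Z).2
  · have hC0 : C 0 = c 0 := by
      simp only [hC, Nat.zero_div, Nat.cast_zero, zero_mul, add_zero]
      congr 1
    rw [hC0] at h0
    have hnn : 0 ≤ (t - c 0) / ℓ := div_nonneg (by linarith) hℓ.le
    set q := ⌊(t - c 0) / ℓ⌋₊ with hq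
    have h1 := Nat.floor_le hnn
    have h2 := Nat.lt_floor_add_one ((t - c 0) / ℓ)
    rw [← hq] at h1 h2
    rw [le_div_iff₀ hℓ] at h1
    rw [div_lt_iff₀ hℓ] at h2
    have hmem : t - q * ℓ ∈ range c := by
      rw [hrange]
      refine ⟨⟨by linarith, by linarith⟩, ?_⟩
      rw [← hZn q]
      simpa using ht
    obtain ⟨j, hj⟩ := hmem
    have hjk : j < Fin.last k := by
      rw [← hc.lt_iff_lt, hj, hlast]
      linarith
    have hjk' : (j : ℕ) < k := hjk
    refine ⟨j + k * q, ?_⟩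
    have e1 : ((j : ℕ) + k * q) % k = j := by rw [Nat.add_mul_mod_self_left, Nat.mod_eq_of_lt hjk']
    have e2 : ((j : ℕ) + k * q) / k = q := by
      rw [Nat.add_mul_div_left _ _ hk, Nat.div_eq_of_lt hjk', zero_add]
    have e3 : Fin.castSucc (⟨((j : ℕ) + k * q) % k, hmod _⟩ : Fin k) = j := by ext; simp [e1]
    simp only [hC, e2, e3, hj]
    ring
  · rw [hlab, hCs, ← hΛn (i / k)]

/-- The periods of a function `σ` whose values between consecutive points of `Z` are determined,
up to translation, by labels that form the word `w ^ m`. -/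
theorem exists_minimal_period {A B X : Type*} {σ : ℝ → X} {ℓ : ℝ} (hℓ : 0 < ℓ)
    (hσ : Function.Periodic σ ℓ) {Z : Set ℝ}
    (hZσ : ∀ τ, (∀ s, σ (s + τ) = σ s) → ∀ s, s + τ ∈ Z ↔ s ∈ Z)
    {w : List A} {m : ℕ} (hw : ¬ IsPeriodicWord w)
    {label : A → B} (hlabel : Function.Injective label) {Λ : ℝ → ℝ → B}
    (hΛ : ∀ τ, (∀ s, σ (s + τ) = σ s) → ∀ s t, Λ (s + τ) (t + τ) = Λ s t)
    (hgap : ∀ a b a' b', a < b → a' < b' → a ∈ Z → b ∈ Z → a' ∈ Z → b' ∈ Z →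
      (∀ x ∈ Ioo a b, x ∉ Z) → (∀ x ∈ Ioo a' b', x ∉ Z) → Λ a b = Λ a' b' →
      b' - a' = b - a ∧ ∀ x ∈ Icc a b, σ x = σ (x + (a' - a)))
    {c : Fin ((wordPow w m).length + 1) → ℝ} (hc : StrictMono c)
    (hlast : c (Fin.last _) = c 0 + ℓ) (hrange : range c = Icc (c 0) (c 0 + ℓ) ∩ Z)
    (hlab : ∀ i, label ((wordPow w m).get i) = Λ (c i.castSucc) (c i.succ)) :
    ∃ T > 0, m * T = ℓ ∧ (∀ s, σ (s + T) = σ s) ∧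
      ∀ τ, 0 ≤ τ → (∀ s, σ (s + τ) = σ s) → ∃ q : ℕ, τ = q * T := by
  obtain ⟨C, hCm, hCk, hCZ, hCsurj, hClab⟩ := exists_periodic_extension hℓ hc hlast
    (hZσ ℓ hσ) hrange (hΛ ℓ hσ) hlab
  rw [wordPow_length] at hCk
  -- The empty word counts as periodic, being its own square.
  have hn : 0 < w.length := by
    rw [List.length_pos_iff]
    rintro rfl
    exact hw ⟨[], 2, one_lt_two, rfl⟩
  have hm : 0 < m := by
    rcases Nat.eq_zero_or_pos m with rfl | h
    · have := hCk 0
      simp only [zero_mul, add_zero] at this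
      linarith
    · exact h
  set n := w.length with hn_def
  have hmod : ∀ i, i % n < n := fun i => Nat.mod_lt i hn
  set e : ℕ → A := fun i => w[i % n]'(hmod i) with he
  have hlen : (wordPow w m).length = m * n := wordPow_length w m
  have hlen0 : 0 < (wordPow w m).length := by rw [hlen]; positivity
  have heΛ : ∀ i, label (e i) = Λ (C i) (C (i + 1)) := by
    intro i
    rw [← hClab i (Nat.mod_lt _ hlen0)]
    congr 1
    rw [List.get_eq_getElem, wordPow_getElem _ _ _ _ (hmod _)]
    change w[i % n]'_ = w[i % (wordPow w m).length % n]'_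
    simp only [hlen, Nat.mod_mul_left_mod]
  have hper : ∀ i, e (i + n) = e i := by
    intro i
    simp [he]
  have hnotZ : ∀ i, ∀ x ∈ Ioo (C i) (C (i + 1)), x ∉ Z := by
    intro i x hx hxZ
    obtain ⟨l, rfl⟩ := hCsurj x hxZ ((hCm.monotone (Nat.zero_le i)).trans hx.1.le)
    have h1 := hCm.lt_iff_lt.1 hx.1
    have h2 := hCm.lt_iff_lt.1 hx.2
    omega
  have hstep : ∀ i, C (i + n + 1) - C (i + n) = C (i + 1) - C i ∧
      ∀ x ∈ Icc (C i) (C (i + 1)), σ x = σ (x + (C (i + n) - C i)) := by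
    intro i
    refine hgap _ _ _ _ (hCm i.lt_succ_self) (hCm (i + n).lt_succ_self) (hCZ _) (hCZ _) (hCZ _)
      (hCZ _) (hnotZ _) (hnotZ _) ?_
    rw [← heΛ, ← heΛ, hper]
  set T := C n - C 0 with hT
  have hT0 : 0 < T := sub_pos.2 (hCm hn)
  have hCn : ∀ i, C (i + n) = C i + T := by
    intro i
    induction i with
    | zero => simp [hT]
    | succ i ih =>
      have h1 := (hstep i).1
      have h2 : i + 1 + n = i + n + 1 := by ring
      rw [h2]
      linarith
  have hCqn : ∀ q i : ℕ, C (i + q * n) = C i + q * T := by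
    intro q
    induction q with
    | zero => simp
    | succ q ih =>
      intro i
      rw [add_mul, one_mul, ← add_assoc, hCn, ih]
      push_cast
      ring
  have hmT : m * T = ℓ := by
    have h1 := hCqn m 0
    rw [hCk] at h1
    linarith
  have hshift : ∀ N, ∀ s ∈ Icc (C 0) (C N), σ s = σ (s + T) := by
    intro N
    induction N with
    | zero =>
      intro s hs
      have h1 := (hstep 0).2 s ⟨hs.1, hs.2.trans (hCm.monotone (Nat.zero_le _))⟩
      rwa [hCn, add_sub_cancel_left] at h1
    | succ N ih =>
      intro s hs
      rcases le_total s (C N) with h | h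
      · exact ih s ⟨hs.1, h⟩
      · have h1 := (hstep N).2 s ⟨h, hs.2⟩
        rwa [hCn, add_sub_cancel_left] at h1
  -- `hshift` only covers parameters from `C 0` on; an arbitrary one is first moved there by a
  -- multiple of the known period `ℓ`.
  have hσT : ∀ s, σ (s + T) = σ s := by
    intro s
    obtain ⟨a, ha⟩ := exists_nat_gt ((C 0 - s) / ℓ)
    rw [div_lt_iff₀ hℓ] at ha
    obtain ⟨b, hb⟩ := exists_nat_gt ((s + a * ℓ - C 0) / T)
    rw [div_lt_iff₀ hT0] at hb
    have h1 := hshift (0 + b * n) (s + a * ℓ) ⟨by linarith, by rw [hCqn]; linarith⟩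
    have h2 : ∀ x, σ (x + a * ℓ) = σ x := fun x => by
      simpa using (hσ.nat_mul a) x
    rw [h2, add_right_comm, h2] at h1
    exact h1.symm
  refine ⟨T, hT0, hmT, hσT, fun τ hτ hστ => ?_⟩
  obtain ⟨j, hj⟩ := hCsurj (C 0 + τ) ((hZσ τ hστ _).2 (hCZ 0)) (by linarith)
  -- Translation by `τ` and by `-τ` preserves `Z` and order, so it takes successors to successors;
  -- each of the two inequalities uses one of these translations.
  have hCj : ∀ i, C (i + j) = C i + τ := by
    intro i
    induction i with
    | zero => simpa using hj
    | succ i ih =>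
      have hCi0 : ∀ l, C 0 ≤ C l := fun l => hCm.monotone (Nat.zero_le l)
      obtain ⟨l, hl⟩ := hCsurj (C (i + 1) + τ) ((hZσ τ hστ _).2 (hCZ _))
        (by linarith [hCi0 (i + 1)])
      have hlt : C i < C (i + 1) := hCm i.lt_succ_self
      have h1 : i + j < l := by
        rw [← hCm.lt_iff_lt]
        linarith
      have h2 : C (i + 1 + j) ≤ C l := hCm.monotone (by omega)
      have hlt' : C (i + j) < C (i + 1 + j) := hCm (by omega)
      obtain ⟨l', hl'⟩ := hCsurj (C (i + 1 + j) - τ)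
        ((hZσ τ hστ _).1 (by simpa using hCZ _)) (by linarith [hCi0 i])
      have h3 : i < l' := by
        rw [← hCm.lt_iff_lt]
        linarith
      have h4 : C (i + 1) ≤ C l' := hCm.monotone (by omega)
      linarith
  have hej : ∀ i, e (i + j) = e i := by
    intro i
    apply hlabel
    rw [heΛ, heΛ, add_right_comm, hCj, hCj, hΛ τ hστ]
  obtain ⟨q, hq⟩ := length_dvd_of_shift_invariant hw (e := e)
    (fun i h => by
    change w[i % n]'_ = _
    simp only [show i % n = i from Nat.mod_eq_of_lt h]) hper hej
  refine ⟨q, ?_⟩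
  have h1 := hCqn q 0
  rw [zero_add, mul_comm q, show n * q = j from hq.symm, hj] at h1
  linarith

theorem eq_of_eq_add_int_mul {x y ℓ : ℝ} (hℓ : 0 < ℓ) (h : ∃ n : ℤ, x = y + n * ℓ)
    (hxy : |x - y| < ℓ) : x = y := by
  obtain ⟨n, hn⟩ := h
  have h1 : |(n : ℝ)| * ℓ < 1 * ℓ := by
    rw [show x - y = n * ℓ by linarith, abs_mul, abs_of_pos hℓ] at hxy
    rwa [one_mul]
  have h2 : |(n : ℝ)| < 1 := lt_of_mul_lt_mul_right h1 hℓ.le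
  have h3 : |n| < 1 := by exact_mod_cast h2
  rw [Int.abs_lt_one_iff.1 h3] at hn
  simpa using hn

/-! ### Closed curves parameterized by arc length -/

/-- `z` is a simple closed curve of length `ℓ` parameterized by arc length, with unit tangent `T`
and curvature `κ`, and the zeros of the derivative `κ'` of the curvature are isolated. -/
structure IsUnitSpeedClosed (z T : ℝ → ℂ) (κ κ' : ℝ → ℝ) (ℓ : ℝ) : Prop where
  hasDerivAt : ∀ s, HasDerivAt z (T s) s
  norm_tangent : ∀ s, ‖T s‖ = 1
  hasDerivAt_tangent : ∀ s, HasDerivAt T (κ s * Complex.I * T s) s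
  hasDerivAt_curvature : ∀ s, HasDerivAt κ (κ' s) s
  continuous_deriv_curvature : Continuous κ'
  length_pos : 0 < ℓ
  periodic : Function.Periodic z ℓ
  eq_add_of_eq : ∀ s t, z s = z t → ∃ n : ℤ, s = t + n * ℓ
  isolated : ∀ t, ∀ᶠ u in 𝓝[≠] t, κ' u ≠ 0

namespace IsUnitSpeedClosed

variable {z T : ℝ → ℂ} {κ κ' : ℝ → ℝ} {ℓ : ℝ}

theorem continuous (h : IsUnitSpeedClosed z T κ κ' ℓ) : Continuous z :=
  continuous_iff_continuousAt.2 fun s => (h.hasDerivAt s).continuousAt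

theorem continuous_tangent (h : IsUnitSpeedClosed z T κ κ' ℓ) : Continuous T :=
  continuous_iff_continuousAt.2 fun s => (h.hasDerivAt_tangent s).continuousAt

theorem tangent_ne_zero (h : IsUnitSpeedClosed z T κ κ' ℓ) (s : ℝ) : T s ≠ 0 := by
  intro h0
  have := h.norm_tangent s
  simp [h0] at this

theorem conj_mul_tangent (h : IsUnitSpeedClosed z T κ κ' ℓ) (s : ℝ) :
    (starRingEnd ℂ) (T s) * T s = 1 := by
  rw [Complex.conj_mul', h.norm_tangent]
  simp

/-- This provides a second point of the curve: an orientation preserving motion is determined by its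
values at two distinct points. -/
theorem ne_add_half (h : IsUnitSpeedClosed z T κ κ' ℓ) (s : ℝ) : z (s + ℓ / 2) ≠ z s := by
  intro he
  obtain ⟨n, hn⟩ := h.eq_add_of_eq _ _ he
  have h1 : ((2 * n - 1 : ℤ) : ℝ) * ℓ = 0 := by push_cast; linarith
  rcases mul_eq_zero.1 h1 with h2 | h2
  · have : 2 * n - 1 = 0 := by exact_mod_cast h2
    omega
  · exact h.length_pos.ne' h2

theorem affine_ext (h : IsUnitSpeedClosed z T κ κ' ℓ) {u v u' v' : ℂ}
    (he : ∀ s, u * z s + v = u' * z s + v') : u = u' ∧ v = v' := by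
  have h1 := he 0
  have h2 := he (0 + ℓ / 2)
  have h3 : (u - u') * (z (0 + ℓ / 2) - z 0) = 0 := by linear_combination h2 - h1
  have hu : u = u' := by
    rcases mul_eq_zero.1 h3 with h4 | h4
    · exact sub_eq_zero.1 h4
    · exact (h.ne_add_half 0 (sub_eq_zero.1 h4)).elim
  subst hu
  exact ⟨rfl, by simpa using h1⟩

/-- Isometries that act as a shift of the arc length parameter preserve the signature. -/
theorem signature_shift (h : IsUnitSpeedClosed z T κ κ' ℓ) {u v : ℂ} {τ : ℝ}
    (he : ∀ s, u * z s + v = z (s + τ)) : ∀ s, (κ (s + τ), κ' (s + τ)) = (κ s, κ' s) := by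
  have h1 : ∀ s, T (s + τ) = u * T s := by
    intro s
    have e1 := (h.hasDerivAt (s + τ)).comp_add_const s τ
    have e2 := ((h.hasDerivAt s).const_mul u).add_const v
    rw [funext he] at e2
    exact e1.unique e2
  have h2 : ∀ s, κ (s + τ) = κ s := by
    intro s
    have e1 := (h.hasDerivAt_tangent (s + τ)).comp_add_const s τ
    have e2 := (h.hasDerivAt_tangent s).const_mul u
    rw [← funext h1] at e2
    have e3 := e1.unique e2
    have e4 : ((κ (s + τ) : ℂ) - κ s) * (Complex.I * T (s + τ)) = 0 := by
      rw [h1] at e3 ⊢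
      linear_combination e3
    rcases mul_eq_zero.1 e4 with h0 | h0
    · exact_mod_cast sub_eq_zero.1 h0
    · exact (mul_ne_zero Complex.I_ne_zero (h.tangent_ne_zero _) h0).elim
  intro s
  have e1 := (h.hasDerivAt_curvature (s + τ)).comp_add_const s τ
  have e2 := h.hasDerivAt_curvature s
  rw [← funext h2] at e2
  exact Prod.ext (h2 s) (e1.unique e2)

/-- A curve is determined by its curvature up to an orientation preserving isometry. -/
theorem exists_isometry_of_shift (h : IsUnitSpeedClosed z T κ κ' ℓ) {τ : ℝ}
    (hκ : ∀ s, κ (s + τ) = κ s) : ∃ a b : ℂ, ∀ s, a * z s + b = z (s + τ) := by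
  have hconst : ∀ (F : ℝ → ℂ), (∀ s, HasDerivAt F 0 s) → ∀ s, F s = F 0 := fun F hF s =>
    is_const_of_deriv_eq_zero (fun x => (hF x).differentiableAt) (fun x => (hF x).deriv) s 0
  set a := T (0 + τ) * (starRingEnd ℂ) (T 0) with ha
  -- Both unit tangents turn at the same rate, so the rotation from one to the other is constant.
  have h1 : ∀ s, T (s + τ) * (starRingEnd ℂ) (T s) = a := by
    refine hconst (fun s => T (s + τ) * (starRingEnd ℂ) (T s)) fun s => ?_
    have e1 := (h.hasDerivAt_tangent (s + τ)).comp_add_const s τ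
    have e2 : HasDerivAt (fun s => (starRingEnd ℂ) (T s))
        ((starRingEnd ℂ) (κ s * Complex.I * T s)) s := (h.hasDerivAt_tangent s).star
    refine (e1.mul e2).congr_deriv ?_
    rw [hκ]
    simp only [map_mul, Complex.conj_I, Complex.conj_ofReal]
    ring
  have h2 : ∀ s, T (s + τ) = a * T s := by
    intro s
    rw [← h1 s, mul_assoc, h.conj_mul_tangent, mul_one]
  refine ⟨a, z (0 + τ) - a * z 0, fun s => ?_⟩
  have h3 : z (s + τ) - a * z s = z (0 + τ) - a * z 0 :=
    hconst (fun s => z (s + τ) - a * z s) (fun s =>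
      (((h.hasDerivAt (s + τ)).comp_add_const s τ).sub ((h.hasDerivAt s).const_mul a)).congr_deriv
        (by rw [h2, sub_self])) s
  rw [← h3]
  ring

/-- A unit speed curve in the image of `z` is locally a reparameterization of `z`. -/
theorem exists_local_lift (h : IsUnitSpeedClosed z T κ κ' ℓ) {w W : ℝ → ℂ}
    (hw : ∀ s, HasDerivAt w (W s) s) (hrange : ∀ s, w s ∈ range z) {s₁ t₁ : ℝ}
    (ht : z t₁ = w s₁) : ∃ r > 0, ∃ ψ : ℝ → ℝ, ψ s₁ = t₁ ∧
      ContinuousOn ψ (Metric.ball s₁ r) ∧ (∀ s ∈ Metric.ball s₁ r, z (ψ s) = w s) ∧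
      ∀ s ∈ Metric.ball s₁ r, ∃ c : ℝ, c = ((starRingEnd ℂ) (T (ψ s)) * W s).re ∧
        HasDerivAt ψ c s ∧ W s = c * T (ψ s) := by
  have hℓ := h.length_pos
  have hcw : Continuous w := continuous_iff_continuousAt.2 fun s => (hw s).continuousAt
  set K := Icc (t₁ - ℓ / 3) (t₁ + ℓ / 3) with hK
  -- `K` and `K₂` together span one period. `K` is short enough for `z` to be injective on it, and
  -- `w s₁` is off the compact image of `K₂`, so near `s₁` the curve `w` lifts through `K`.
  set K₂ := Icc (t₁ + ℓ / 3) (t₁ + 2 * ℓ / 3) with hK₂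
  have small : ∀ x y, |x - y| < ℓ → z x = z y → x = y := fun x y hxy he =>
    eq_of_eq_add_int_mul hℓ (h.eq_add_of_eq x y he) hxy
  have hinj : InjOn z K := fun x hx y hy he =>
    small x y (by rw [abs_lt]; constructor <;> linarith [hx.1, hx.2, hy.1, hy.2]) he
  have hcover : ∀ s, w s ∈ z '' K ∪ z '' K₂ := by
    intro s
    obtain ⟨x, hx⟩ := hrange s
    obtain ⟨y, hy, hxy⟩ := h.periodic.exists_mem_Ico hℓ x (t₁ - ℓ / 3)
    rw [← hx, hxy]
    rcases le_total y (t₁ + ℓ / 3) with hle | hle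
    · exact Or.inl ⟨y, ⟨hy.1, hle⟩, rfl⟩
    · exact Or.inr ⟨y, ⟨hle, by linarith [hy.2]⟩, rfl⟩
  have hclosed : IsClosed (z '' K₂) := (isCompact_Icc.image h.continuous).isClosed
  have hnot : w s₁ ∉ z '' K₂ := by
    rintro ⟨y, hy, he⟩
    have := small y t₁ (by rw [abs_lt]; constructor <;> linarith [hy.1, hy.2]) (he.trans ht.symm)
    linarith [hy.1]
  obtain ⟨r, hr, hball⟩ := Metric.eventually_nhds_iff_ball.1
    (hcw.continuousAt.eventually (hclosed.isOpen_compl.mem_nhds hnot))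
  obtain ⟨ψ, hψ, hψK⟩ := exists_continuousOn_lift (s := Metric.ball s₁ r) isCompact_Icc
    h.continuous.continuousOn hinj hcw.continuousOn
    (fun s hs => (hcover s).resolve_right (hball s hs))
  have hs₁ := Metric.mem_ball_self (x := s₁) hr
  refine ⟨r, hr, ψ, hinj (hψK s₁ hs₁).1 ⟨by linarith, by linarith⟩
    ((hψK s₁ hs₁).2.trans ht.symm), hψ, fun s hs => (hψK s hs).2, fun s hs => ?_⟩
  have hnhds := Metric.isOpen_ball.mem_nhds hs
  set T₀ := (starRingEnd ℂ) (T (ψ s)) with hT₀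
  have hre : ∀ {F : ℝ → ℂ} {F' : ℂ} {x : ℝ}, HasDerivAt F F' x →
      HasDerivAt (fun y => (T₀ * F y).re) (T₀ * F').re x := fun hF =>
    Complex.reCLM.hasFDerivAt.comp_hasDerivAt _ (hF.const_mul T₀)
  -- Projecting to the tangent line at `ψ s` gives a real function with derivative 1 there, to which
  -- the inverse function argument applies.
  have hstrict : HasStrictDerivAt (fun y => (T₀ * z y).re) (T₀ * T (ψ s)).re (ψ s) := by
    refine hasStrictDerivAt_of_hasDerivAt_of_continuousAt
      (f' := fun y => (T₀ * T y).re) (Eventually.of_forall fun y => hre (h.hasDerivAt y)) ?_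
    exact (Complex.continuous_re.comp (continuous_const.mul h.continuous_tangent)).continuousAt
  have hone : (T₀ * T (ψ s)).re = 1 := by rw [hT₀, h.conj_mul_tangent, Complex.one_re]
  have hev : ∀ᶠ u in 𝓝 s, z (ψ u) = w u := by
    filter_upwards [hnhds] with u hu
    exact (hψK u hu).2
  have hder := hasDerivAt_of_comp_eventuallyEq hstrict (by rw [hone]; exact one_ne_zero)
    (hre (hw s)) (hψ.continuousAt hnhds) (hev.mono fun u hu => by rw [hu])
  rw [hone, inv_one, one_mul] at hder
  refine ⟨_, rfl, hder, ?_⟩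
  have h1 := (h.hasDerivAt (ψ s)).scomp s hder
  have h2 := (hw s).congr_of_eventuallyEq (f₁ := z ∘ ψ) hev
  rw [← Complex.real_smul]
  exact h2.unique h1

/-- A unit speed curve in the image of `z` is a reparameterization of `z`. -/
theorem exists_eq_reparam (h : IsUnitSpeedClosed z T κ κ' ℓ) {w W : ℝ → ℂ}
    (hw : ∀ s, HasDerivAt w (W s) s) (hW : Continuous W) (hW1 : ∀ s, ‖W s‖ = 1)
    (hrange : ∀ s, w s ∈ range z) :
    ∃ ε t : ℝ, (ε = 1 ∨ ε = -1) ∧ ∀ s, w s = z (t + ε * s) := by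
  have hcw : Continuous w := continuous_iff_continuousAt.2 fun s => (hw s).continuousAt
  have hunit : ∀ {c : ℝ} {s t : ℝ}, W s = c * T t → c = 1 ∨ c = -1 := by
    intro c s t hc
    have := congrArg norm hc
    rw [hW1, norm_mul, h.norm_tangent, mul_one, Complex.norm_real, Real.norm_eq_abs] at this
    exact eq_or_eq_neg_of_abs_eq this.symm
  obtain ⟨t, ht⟩ := hrange 0
  obtain ⟨r, hr, ψ, hψ0, -, -, hψ⟩ := h.exists_local_lift hw hrange ht
  obtain ⟨ε, -, -, hε⟩ := hψ 0 (Metric.mem_ball_self hr)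
  rw [hψ0] at hε
  have hε1 := hunit hε
  refine ⟨ε, t, hε1, ?_⟩
  have hline : Continuous fun s : ℝ => t + ε * s := by fun_prop
  -- The tangent is carried along with the position so that agreement at one parameter also fixes
  -- the direction of travel, hence agreement nearby.
  have key : EqOn (fun s => (w s, W s)) (fun s => (z (t + ε * s), (ε : ℂ) * T (t + ε * s)))
      univ := by
    refine isPreconnected_univ.eqOn_of_eventually_eq (hcw.prodMk hW)
      ((h.continuous.comp hline).prodMk (continuous_const.mul (h.continuous_tangent.comp hline)))
      ?_ (mem_univ 0) (by simp [ht, hε])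
    intro s₂ _ hs₂
    simp only [Prod.mk.injEq] at hs₂
    obtain ⟨r, hr, ψ, hψ2, hψc, hψz, hψ⟩ := h.exists_local_lift hw hrange hs₂.1.symm
    have hs₂r := Metric.mem_ball_self (x := s₂) hr
    set c : ℝ → ℝ := fun s => ((starRingEnd ℂ) (T (ψ s)) * W s).re with hc
    have hcc : ContinuousAt c s₂ := by
      have h1 : ContinuousAt ψ s₂ := hψc.continuousAt (Metric.isOpen_ball.mem_nhds hs₂r)
      have h2 : ContinuousAt (fun s => T (ψ s)) s₂ :=
        ContinuousAt.comp (h.continuous_tangent.continuousAt) h1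
      exact Complex.continuous_re.continuousAt.comp
        ((Complex.continuous_conj.continuousAt.comp h2).mul hW.continuousAt)
    have hcε : c s₂ = ε := by
      simp only [hc, hψ2, hs₂.2]
      rw [mul_left_comm, h.conj_mul_tangent, mul_one, Complex.ofReal_re]
    -- The slope takes only the values 1 and -1, so keeping its sign means staying equal to `ε`.
    have hpos : ∀ᶠ s in 𝓝 s₂, 0 < c s * ε := by
      refine (hcc.mul continuousAt_const).eventually (lt_mem_nhds ?_)
      change 0 < c s₂ * ε
      rw [hcε]
      rcases hε1 with h1 | h1 <;> rw [h1] <;> norm_num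
    obtain ⟨ρ, hρ, hρball⟩ := Metric.eventually_nhds_iff_ball.1
      (hpos.and (Metric.ball_mem_nhds s₂ hr))
    have hder : ∀ s ∈ Metric.ball s₂ ρ, HasDerivAt ψ ε s ∧ W s = ε * T (ψ s) := by
      intro s hs
      obtain ⟨h1, h2⟩ := hρball s hs
      obtain ⟨c', hc', hd, hWs⟩ := hψ s h2
      have : c' = ε := by
        rw [show c s = c' from hc'.symm] at h1
        rcases hunit hWs with h3 | h3 <;> rcases hε1 with h4 | h4 <;> rw [h3, h4] at h1 ⊢ <;>
          linarith
      exact this ▸ ⟨hd, hWs⟩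
    have hlin := eq_add_mul_of_hasDerivAt_ne
      (hψc.mono fun s hs => (hρball s hs).2) fun s hs _ => (hder s hs).1
    filter_upwards [Metric.ball_mem_nhds s₂ hρ] with s hs
    have e : ψ s = t + ε * s := by
      rw [hlin s hs, hψ2]
      ring
    rw [← e, hψz s (hρball s hs).2, ← (hder s hs).2]
  intro s
  exact congrArg Prod.fst (key (mem_univ s))

/-- An orientation preserving isometry that preserves the curve shifts the arc length. -/
theorem exists_shift_of_isometry (h : IsUnitSpeedClosed z T κ κ' ℓ) {a b : ℂ} (ha : ‖a‖ = 1)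
    (hab : ∀ s, a * z s + b ∈ range z) : ∃ τ, 0 ≤ τ ∧ ∀ s, a * z s + b = z (s + τ) := by
  obtain ⟨ε, t, hε, ht⟩ := h.exists_eq_reparam (w := fun s => a * z s + b) (W := fun s => a * T s)
    (fun s => ((h.hasDerivAt s).const_mul a).add_const b)
    (continuous_const.mul h.continuous_tangent) (fun s => by rw [norm_mul, ha, h.norm_tangent, one_mul])
    hab
  have hℓ := h.length_pos
  rcases hε with rfl | rfl
  · obtain ⟨n, hn⟩ := exists_nat_gt (-t / ℓ)
    rw [div_lt_iff₀ hℓ] at hn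
    refine ⟨t + n * ℓ, by linarith, fun s => ?_⟩
    have h1 : z (s + t + n * ℓ) = z (s + t) := (h.periodic.nat_mul n) (s + t)
    rw [ht, ← add_assoc, h1, one_mul, add_comm]
  -- Reversing the parameter, s ↦ t - s, fixes the points at t/2 and t/2 + ℓ/2. These are distinct,
  -- so the motion is the identity, yet it exchanges the distinct points at t/2 ± ℓ/4.
  · exfalso
    have h1 : a * z (t / 2) + b = z (t / 2) := by
      rw [ht]
      congr 1
      ring
    have h2 : a * z (t / 2 + ℓ / 2) + b = z (t / 2 + ℓ / 2) := by
      rw [ht, ← h.periodic]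
      congr 1
      ring
    have h3 : (a - 1) * (z (t / 2 + ℓ / 2) - z (t / 2)) = 0 := by linear_combination h2 - h1
    have ha1 : a = 1 := by
      rcases mul_eq_zero.1 h3 with h4 | h4
      · exact sub_eq_zero.1 h4
      · exact (h.ne_add_half _ (sub_eq_zero.1 h4)).elim
    have hb0 : b = 0 := by
      rw [ha1, one_mul] at h1
      simpa using h1
    have h5 := ht (t / 2 + ℓ / 4)
    rw [ha1, hb0, one_mul, add_zero] at h5
    apply h.ne_add_half (t / 2 - ℓ / 4)
    convert h5 using 2 <;> ring

/-- If `P` is the minimal period of the signature and `m * P` is the length of the curve then the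
symmetries of the curve are the powers of a rotation of order `m`. -/
theorem exists_primitive_rotation (h : IsUnitSpeedClosed z T κ κ' ℓ) {P : ℝ} (hP : 0 < P) {m : ℕ}
    (hm : m * P = ℓ) (hκ : ∀ s, (κ (s + P), κ' (s + P)) = (κ s, κ' s))
    (hmin : ∀ τ, 0 ≤ τ → (∀ s, (κ (s + τ), κ' (s + τ)) = (κ s, κ' s)) → ∃ q : ℕ, τ = q * P) :
    ∃ a C : ℂ, IsPrimitiveRoot a m ∧ ∀ u v : ℂ, ‖u‖ = 1 →
      ((fun x => u * x + v) '' range z = range z ↔ ∃ q : ℕ, ∀ x, u * x + v = a ^ q * (x - C) + C) := by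
  obtain ⟨a, b, hab⟩ := h.exists_isometry_of_shift fun s => congrArg Prod.fst (hκ s)
  have hdvd : ∀ l : ℕ, (∀ s, z (s + l * P) = z s) → m ∣ l := by
    intro l hl
    obtain ⟨n, hn⟩ := h.eq_add_of_eq _ _ (hl 0)
    rw [← hm] at hn
    have h1 : ((l : ℝ) - n * m) * P = 0 := by linarith
    rcases mul_eq_zero.1 h1 with h2 | h2
    · have h3 : (l : ℤ) = n * m := by
        have := sub_eq_zero.1 h2
        exact_mod_cast this
      exact Int.natCast_dvd_natCast.1 ⟨n, by rw [h3, mul_comm]⟩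
    · exact (hP.ne' h2).elim
  have hper : ∀ s, z (s + m * P) = z s := by
    intro s
    rw [hm]
    exact h.periodic s
  -- The centre is the fixed point b/(1 - a) if a ≠ 1. If a = 1, the motion is a translation by b,
  -- and closing up after `m` steps forces m b = 0, so any centre will do.
  obtain ⟨C, hC⟩ : ∃ C, ∀ s, z (s + P) - C = a * (z s - C) := by
    by_cases ha : a = 1
    · have hb : ∀ (l : ℕ) s, z (s + l * P) = z s + l * b := by
        intro l
        induction l with
        | zero => simp
        | succ l ih =>
          intro s
          have := hab (s + l * P)
          rw [ih, ha, one_mul] at this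
          push_cast
          rw [add_mul, one_mul, ← add_assoc, ← this]
          ring
      have hm0 : (m : ℂ) ≠ 0 := by
        rintro hm0
        have : m = 0 := by exact_mod_cast hm0
        rw [this, Nat.cast_zero, zero_mul] at hm
        exact h.length_pos.ne hm
      have hb0 : b = 0 := by
        have h1 := hb m 0
        rw [hper] at h1
        have h2 : (m : ℂ) * b = 0 := by linear_combination -h1
        exact (mul_eq_zero.1 h2).resolve_left hm0
      exact ⟨0, fun s => by rw [← hab, hb0]; ring⟩
    · have ha' : 1 - a ≠ 0 := sub_ne_zero.2 (Ne.symm ha)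
      refine ⟨b / (1 - a), fun s => ?_⟩
      rw [← hab]
      field_simp
      ring
  have hCq : ∀ (q : ℕ) s, z (s + q * P) = a ^ q * (z s - C) + C := by
    intro q
    induction q with
    | zero => simp
    | succ q ih =>
      intro s
      have h1 := hC (s + q * P)
      rw [ih] at h1
      push_cast
      rw [add_mul, one_mul, ← add_assoc]
      linear_combination h1
  have hpow : ∀ q : ℕ, (∀ s, z (s + q * P) = z s) ↔ a ^ q = 1 := by
    intro q
    constructor
    · intro hq
      refine (h.affine_ext (u := a ^ q) (v := C - a ^ q * C) (u' := 1) (v' := 0) fun s => ?_).1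
      have := hCq q s
      rw [hq] at this
      linear_combination -this
    · intro hq s
      rw [hCq, hq]
      ring
  refine ⟨a, C, ⟨(hpow m).1 hper, fun l hl => hdvd l ((hpow l).2 hl)⟩, fun u v hu => ?_⟩
  constructor
  · intro himg
    obtain ⟨τ, hτ0, hτ⟩ := h.exists_shift_of_isometry (b := v) hu fun s =>
      himg ▸ mem_image_of_mem _ (mem_range_self s)
    obtain ⟨q, rfl⟩ := hmin τ hτ0 (h.signature_shift hτ)
    refine ⟨q, fun x => ?_⟩
    obtain ⟨rfl, rfl⟩ := h.affine_ext (u := u) (v := v) (u' := a ^ q) (v' := C - a ^ q * C)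
      fun s => by rw [hτ, hCq]; ring
    ring
  · rintro ⟨q, hq⟩
    rw [← range_comp]
    have : (fun x => u * x + v) ∘ z = z ∘ fun s => s + q * P := by
      ext s
      simp only [Function.comp, hq, hCq]
    rw [this]
    exact (add_right_surjective ((q : ℝ) * P)).range_comp z

end IsUnitSpeedClosed

/-! ### The arc length parameterization -/

/-- The identification of the Euclidean plane with the complex plane. -/
noncomputable def planeToComplex : Plane ≃ₗᵢ[ℝ] ℂ :=
  Complex.orthonormalBasisOneI.repr.symm

theorem planeToComplex_apply (x : Plane) : planeToComplex x = x 0 + x 1 * Complex.I :=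
  Complex.orthonormalBasisOneI_repr_symm_apply x

theorem planeToComplex_re (x : Plane) : (planeToComplex x).re = x 0 := by
  simp [planeToComplex_apply]

theorem planeToComplex_im (x : Plane) : (planeToComplex x).im = x 1 := by
  simp [planeToComplex_apply]

/-- The rotation rate of the unit tangent. -/
theorem hasDerivAt_unit_tangent {g : ℝ → ℂ} {g' : ℂ} {t : ℝ} (hg : HasDerivAt g g' t)
    (h0 : g t ≠ 0) :
    HasDerivAt (fun t => ((‖g t‖⁻¹ : ℝ) : ℂ) * g t)
      ((((g t).re * g'.im - (g t).im * g'.re) / ‖g t‖ ^ 3 : ℝ) * Complex.I * g t) t := by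
  have hre : HasDerivAt (fun t => (g t).re) g'.re t :=
    Complex.reCLM.hasFDerivAt.comp_hasDerivAt t hg
  have him : HasDerivAt (fun t => (g t).im) g'.im t :=
    Complex.imCLM.hasFDerivAt.comp_hasDerivAt t hg
  have hpos : 0 < ‖g t‖ := norm_pos_iff.2 h0
  have hsq : ∀ t, ‖g t‖ = Real.sqrt ((g t).re * (g t).re + (g t).im * (g t).im) := fun t => by
    rw [Complex.norm_def, Complex.normSq_apply]
  have hq : (g t).re * (g t).re + (g t).im * (g t).im = ‖g t‖ ^ 2 := by
    rw [← Complex.normSq_apply, Complex.normSq_eq_norm_sq]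
  have hn : HasDerivAt (fun t => ‖g t‖) (((g t).re * g'.re + (g t).im * g'.im) / ‖g t‖) t := by
    have h1 := ((hre.mul hre).add (him.mul him)).sqrt (by
      simp only [Pi.add_apply, Pi.mul_apply, hq]
      positivity)
    have h2 : (fun t => ‖g t‖) = fun t => Real.sqrt ((g t).re * (g t).re + (g t).im * (g t).im) :=
      funext hsq
    rw [h2]
    refine h1.congr_deriv ?_
    change _ / (2 * Real.sqrt ((g t).re * (g t).re + (g t).im * (g t).im)) = _
    rw [← hsq]
    field_simp
    ring
  have h1 := (hn.inv hpos.ne').ofReal_comp.mul hg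
  refine h1.congr_deriv ?_
  apply Complex.ext
  · simp only [Complex.add_re, Complex.mul_re, Complex.mul_im, Complex.ofReal_re, Complex.ofReal_im,
      Complex.I_re, Complex.I_im]
    simp only [Pi.inv_apply]
    field_simp
    linear_combination (-g'.re) * hq
  · simp only [Complex.add_im, Complex.mul_re, Complex.mul_im, Complex.ofReal_re, Complex.ofReal_im,
      Complex.I_re, Complex.I_im]
    simp only [Pi.inv_apply]
    field_simp
    linear_combination (-g'.im) * hq

namespace IsSimpleClosed

variable {γ : ℝ → Plane} {L : ℝ}

theorem contDiff_deriv (h : IsSimpleClosed γ L) : ContDiff ℝ 2 (deriv γ) :=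
  (contDiff_succ_iff_deriv.1 (h.contDiff.of_le (by norm_num : (2 : WithTop ℕ∞) + 1 ≤ 3))).2.2

theorem contDiff_deriv_deriv (h : IsSimpleClosed γ L) : ContDiff ℝ 1 (deriv (deriv γ)) :=
  (contDiff_succ_iff_deriv.1
    (h.contDiff_deriv.of_le (by norm_num : (1 : WithTop ℕ∞) + 1 ≤ 2))).2.2

theorem contDiff_curvature (h : IsSimpleClosed γ L) : ContDiff ℝ 1 (curvature γ) := by
  have h1 : ContDiff ℝ 1 (deriv γ) := h.contDiff_deriv.of_le (by norm_num)
  have hc : ∀ i, ContDiff ℝ 1 fun t => deriv γ t i := contDiff_euclidean.1 h1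
  have hc' : ∀ i, ContDiff ℝ 1 fun t => deriv (deriv γ) t i :=
    contDiff_euclidean.1 h.contDiff_deriv_deriv
  exact (((hc 0).mul (hc' 1)).sub ((hc 1).mul (hc' 0))).div ((h1.norm ℝ h.regular).pow 3)
    fun t => pow_ne_zero 3 (norm_ne_zero_iff.2 (h.regular t))

theorem continuous_curvatureDot (h : IsSimpleClosed γ L) : Continuous (curvatureDot γ) :=
  (h.contDiff_curvature.continuous_deriv le_rfl).div h.contDiff_deriv.continuous.norm
    fun t => norm_ne_zero_iff.2 (h.regular t)

theorem eq_add_of_eq (h : IsSimpleClosed γ L) {s t : ℝ} (he : γ s = γ t) :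
    ∃ n : ℤ, s = t + n * L := by
  have hred : ∀ x, ∃ n : ℤ, x - n * L ∈ Ico 0 L := fun x =>
    ⟨toIcoDiv h.period_pos 0 x, by
      have := sub_toIcoDiv_zsmul_mem_Ico h.period_pos 0 x
      rwa [zero_add, zsmul_eq_mul] at this⟩
  obtain ⟨a, ha⟩ := hred s
  obtain ⟨b, hb⟩ := hred t
  have := h.injOn ha hb (by
    rw [h.periodic.sub_int_mul_eq, h.periodic.sub_int_mul_eq, he])
  exact ⟨a - b, by push_cast; linarith⟩

/-- The speed is periodic, so the arc length gains a fixed positive amount ℓ over each period; this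
makes it onto ℝ. -/
theorem exists_arcLength (h : IsSimpleClosed γ L) : ∃ (S : ℝ ≃o ℝ) (ℓ : ℝ), 0 < ℓ ∧
    (∀ t, HasDerivAt S ‖deriv γ t‖ t) ∧ ∀ t, S (t + L) = S t + ℓ := by
  have hvc : Continuous fun t => ‖deriv γ t‖ := h.contDiff_deriv.continuous.norm
  set S₀ : ℝ → ℝ := fun t => ∫ x in (0 : ℝ)..t, ‖deriv γ x‖ with hS₀
  have hd : ∀ t, HasDerivAt S₀ ‖deriv γ t‖ t := fun t =>
    (hvc.integral_hasStrictDerivAt 0 t).hasDerivAt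
  have hmono : StrictMono S₀ := strictMono_of_deriv_pos fun t => by
    rw [(hd t).deriv]
    exact norm_pos_iff.2 (h.regular t)
  have hc : Continuous S₀ := continuous_iff_continuousAt.2 fun t => (hd t).continuousAt
  have hvper : ∀ t, ‖deriv γ (t + L)‖ = ‖deriv γ t‖ := fun t => by
    rw [← deriv_comp_add_const, funext h.periodic]
  have hper : ∀ t, S₀ (t + L) - S₀ t = S₀ (0 + L) - S₀ 0 := fun t => by
    have hF : ∀ t, HasDerivAt (fun t => S₀ (t + L) - S₀ t) 0 t := fun t => by
      exact (((hd (t + L)).comp_add_const t L).sub (hd t)).congr_deriv (by rw [hvper, sub_self])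
    exact is_const_of_deriv_eq_zero (fun x => (hF x).differentiableAt) (fun x => (hF x).deriv) t 0
  set ℓ := S₀ (0 + L) - S₀ 0 with hℓ
  have hℓ0 : 0 < ℓ := sub_pos.2 (hmono (by linarith [h.period_pos]))
  have hnat : ∀ (n : ℕ) t, S₀ (t + n * L) = S₀ t + n * ℓ := by
    intro n
    induction n with
    | zero => simp
    | succ n ih =>
      intro t
      have h1 := hper (t + n * L)
      rw [ih] at h1
      have h2 : t + ((n + 1 : ℕ) : ℝ) * L = t + n * L + L := by push_cast; ring
      rw [h2]
      push_cast
      linarith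
  have hsurj : Function.Surjective S₀ := by
    intro y
    obtain ⟨n, hn⟩ := exists_nat_gt (|y - S₀ 0| / ℓ)
    rw [div_lt_iff₀ hℓ0] at hn
    obtain ⟨h1, h2⟩ := abs_lt.1 hn
    refine mem_range_of_exists_le_of_exists_ge hc ⟨0 - n * L, ?_⟩ ⟨0 + n * L, ?_⟩
    · have := hnat n (0 - n * L)
      rw [sub_add_cancel] at this
      linarith
    · rw [hnat]
      linarith
  exact ⟨hmono.orderIsoOfSurjective S₀ hsurj, ℓ, hℓ0, hd, fun t => by
    have := hper t
    simp only [StrictMono.coe_orderIsoOfSurjective]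
    linarith⟩

theorem exists_unitSpeed (h : IsSimpleClosed γ L) (hnd : IsNondegenerate γ) :
    ∃ (S : ℝ ≃o ℝ) (z T : ℝ → ℂ) (κ κ' : ℝ → ℝ) (ℓ : ℝ), IsUnitSpeedClosed z T κ κ' ℓ ∧
      (∀ t, z (S t) = planeToComplex (γ t)) ∧ (∀ t, (κ (S t), κ' (S t)) = sigMap γ t) ∧
      ∀ t, S (t + L) = S t + ℓ := by
  obtain ⟨S, ℓ, hℓ, hS, hSL⟩ := h.exists_arcLength
  have hv0 : ∀ t, ‖deriv γ t‖ ≠ 0 := fun t => norm_ne_zero_iff.2 (h.regular t)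
  have hRc : Continuous S.symm := S.symm.continuous
  have hR : ∀ s, HasDerivAt S.symm ‖deriv γ (S.symm s)‖⁻¹ s := fun s =>
    HasDerivAt.of_local_left_inverse hRc.continuousAt (hS _) (hv0 _)
      (Eventually.of_forall S.apply_symm_apply)
  have hRL : ∀ s, S.symm (s + ℓ) = S.symm s + L := fun s => by
    rw [← S.symm_apply_apply (S.symm s + L), hSL, S.apply_symm_apply]
  -- Subtracting the linear function of slope ℓ/L from `S` leaves an L-periodic function, which
  -- gives negative multiples as well.
  have hSint : ∀ (n : ℤ) t, S (t + n * L) = S t + n * ℓ := by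
    have hp : Function.Periodic (fun t => S t - t * (ℓ / L)) L := fun t => by
      have := h.period_pos.ne'
      simp only [hSL]
      field_simp
      ring
    intro n t
    have h1 := hp.int_mul n t
    have := h.period_pos.ne'
    have h2 : (t + n * L) * (ℓ / L) = t * (ℓ / L) + n * ℓ := by field_simp
    rw [h2] at h1
    linarith
  have heq : ∀ s t, γ (S.symm s) = γ (S.symm t) → ∃ n : ℤ, s = t + n * ℓ := by
    intro s t hst
    obtain ⟨n, hn⟩ := h.eq_add_of_eq hst
    refine ⟨n, ?_⟩
    rw [← S.apply_symm_apply s, hn, hSint, S.apply_symm_apply]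
  have hγ0 : ∀ t, HasDerivAt γ (deriv γ t) t := fun t =>
    (h.contDiff.differentiable (by norm_num) t).hasDerivAt
  have hγ1 : ∀ t, HasDerivAt (deriv γ) (deriv (deriv γ) t) t := fun t =>
    (h.contDiff_deriv.differentiable (by norm_num) t).hasDerivAt
  have hg : ∀ {f : ℝ → Plane} {f' : Plane} {t : ℝ}, HasDerivAt f f' t →
      HasDerivAt (fun t => planeToComplex (f t)) (planeToComplex f') t := fun hf =>
    planeToComplex.toContinuousLinearEquiv.hasFDerivAt.comp_hasDerivAt _ hf
  have hcγ : Continuous γ := h.contDiff.continuous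
  refine ⟨S, fun s => planeToComplex (γ (S.symm s)),
    fun s => ((‖planeToComplex (deriv γ (S.symm s))‖⁻¹ : ℝ) : ℂ) * planeToComplex (deriv γ (S.symm s)),
    fun s => curvature γ (S.symm s), fun s => curvatureDot γ (S.symm s), ℓ,
    ⟨fun s => ?_, fun s => ?_, fun s => ?_, fun s => ?_, ?_, hℓ, fun s => ?_, fun s t hst => ?_,
      fun t => ?_⟩, fun t => by simp, fun t => by simp [sigMap], hSL⟩
  · refine ((hg (hγ0 (S.symm s))).scomp s (hR s)).congr_deriv ?_
    rw [Complex.real_smul, LinearIsometryEquiv.norm_map]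
  · rw [norm_mul, Complex.norm_real, norm_inv, norm_norm, inv_mul_cancel₀]
    rw [LinearIsometryEquiv.norm_map]
    exact hv0 _
  · have h1 := (hasDerivAt_unit_tangent (hg (hγ1 (S.symm s)))
      (by simpa using h.regular (S.symm s))).scomp s (hR s)
    refine h1.congr_deriv ?_
    simp only [planeToComplex_re, planeToComplex_im, LinearIsometryEquiv.norm_map, curvature,
      Complex.real_smul]
    push_cast
    ring
  · exact (h.contDiff_curvature.differentiable (by norm_num) (S.symm s)).hasDerivAt.comp s (hR s)
  · exact h.continuous_curvatureDot.comp hRc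
  · simp only [hRL]
    rw [h.periodic]
  · exact heq s t (planeToComplex.injective hst)
  · have hcont : Continuous fun u => curvatureDot γ (S.symm u) := h.continuous_curvatureDot.comp hRc
    -- Nondegeneracy isolates vertices as points of the plane. Parameters closer than ℓ with the
    -- same image coincide, so the vertex parameters are isolated too.
    by_cases h0 : curvatureDot γ (S.symm t) = 0
    · obtain ⟨U, hU, hUv⟩ := hnd (γ (S.symm t)) ⟨_, h0, rfl⟩
      have hmem : γ (S.symm t) ∈ U := (hUv ▸ mem_singleton _ : γ (S.symm t) ∈ U ∩ _).1
      rw [eventually_nhdsWithin_iff]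
      filter_upwards [(hcγ.comp hRc).continuousAt.eventually (hU.mem_nhds hmem),
        Metric.ball_mem_nhds t hℓ] with u hu hut hne hzero
      have h1 : γ (S.symm u) ∈ U ∩ curveVertices γ := ⟨hu, _, hzero, rfl⟩
      rw [hUv] at h1
      exact hne (eq_of_eq_add_int_mul hℓ (heq u t h1) hut)
    · exact (hcont.continuousAt.eventually_ne h0).filter_mono nhdsWithin_le_nhds

end IsSimpleClosed

/-! ### Rotations and the special Euclidean group -/

/-- A linear isometry of ℂ is a rotation or a rotation after conjugation; the determinant excludes
the second. -/
theorem SE2.exists_eq_mul_add (g : SE2) : ∃ u v : ℂ, ‖u‖ = 1 ∧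
    ∀ x, planeToComplex ((g : Plane ≃ᵃⁱ[ℝ] Plane) x) = u * planeToComplex x + v := by
  obtain ⟨g, hg⟩ := g
  set A := g.linearIsometryEquiv with hA
  have hdet : LinearMap.det (A.toLinearEquiv : Plane →ₗ[ℝ] Plane) = 1 := hg
  have hgx : ∀ x, g x = A x + g 0 := fun x => by
    have := g.map_vadd 0 x
    simpa using this
  set f : ℂ ≃ₗᵢ[ℝ] ℂ := planeToComplex.symm.trans (A.trans planeToComplex) with hf
  have hfdet : LinearMap.det (f.toLinearEquiv : ℂ →ₗ[ℝ] ℂ) = 1 := by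
    rw [← hdet]
    exact LinearMap.det_conj _ planeToComplex.toLinearEquiv
  have hAf : ∀ x, planeToComplex (A x) = f (planeToComplex x) := fun x => by simp [hf]
  obtain ⟨a, ha | ha⟩ := linear_isometry_complex f
  · refine ⟨a, planeToComplex (g 0), a.norm_coe, fun x => ?_⟩
    change planeToComplex (g x) = _
    rw [hgx, map_add, hAf, ha, rotation_apply]
  · exfalso
    have h1 : (f.toLinearEquiv : ℂ →ₗ[ℝ] ℂ) = ((rotation a).toLinearEquiv : ℂ →ₗ[ℝ] ℂ) *
        (Complex.conjLIE.toLinearEquiv : ℂ →ₗ[ℝ] ℂ) := by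
      rw [ha]
      rfl
    have h2 : LinearMap.det (Complex.conjLIE.toLinearEquiv : ℂ →ₗ[ℝ] ℂ) = -1 := Complex.det_conjAe
    rw [h1, map_mul, det_rotation, h2] at hfdet
    norm_num at hfdet

theorem SE2.exists_of_mul_add {u : ℂ} (hu : ‖u‖ = 1) (v : ℂ) : ∃ g : SE2,
    ∀ x, planeToComplex ((g : Plane ≃ᵃⁱ[ℝ] Plane) x) = u * planeToComplex x + v := by
  obtain ⟨a, rfl⟩ : ∃ a : Circle, (a : ℂ) = u := ⟨⟨u, mem_sphere_zero_iff_norm.2 hu⟩, rfl⟩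
  set A : Plane ≃ₗᵢ[ℝ] Plane := planeToComplex.trans ((rotation a).trans planeToComplex.symm) with hA
  have hdet : LinearMap.det (A.toLinearEquiv : Plane →ₗ[ℝ] Plane) = 1 := by
    have h1 : (A.toLinearEquiv : Plane →ₗ[ℝ] Plane) =
        (planeToComplex.symm.toLinearEquiv : ℂ →ₗ[ℝ] Plane) ∘ₗ
          ((rotation a).toLinearEquiv : ℂ →ₗ[ℝ] ℂ) ∘ₗ
            (planeToComplex.symm.toLinearEquiv.symm : Plane →ₗ[ℝ] ℂ) := LinearMap.ext fun x => rfl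
    rw [h1, LinearMap.det_conj, det_rotation]
  set g : Plane ≃ᵃⁱ[ℝ] Plane := A.toAffineIsometryEquiv.trans
    (AffineIsometryEquiv.constVAdd ℝ Plane (planeToComplex.symm v)) with hg
  have hlin : g.linearIsometryEquiv = A := by
    ext1 x
    rfl
  refine ⟨⟨g, ?_⟩, fun x => ?_⟩
  · change LinearMap.det (g.linearIsometryEquiv.toLinearEquiv : Plane →ₗ[ℝ] Plane) = 1
    rw [hlin, hdet]
  · change planeToComplex (planeToComplex.symm v + A x) = _
    simp [hA, add_comm]

theorem planeToComplex_rotationAbout (C : Plane) (θ : ℝ) (x : Plane) :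
    planeToComplex (rotationAbout C θ x) =
      Complex.exp (θ * Complex.I) * (planeToComplex x - planeToComplex C) + planeToComplex C := by
  rw [Complex.exp_mul_I, ← Complex.ofReal_cos, ← Complex.ofReal_sin]
  simp only [planeToComplex_apply, rotationAbout]
  generalize Real.cos θ = c
  generalize Real.sin θ = s
  apply Complex.ext <;> simp <;> ring

/-! ### Cyclic symmetry groups and the labels of edges. -/

theorem card_and_equiv_zmod_of_generator {G : Type*} [Group G] {g : G} {m : ℕ} (hm : m ≠ 0)
    (hg : ∀ k : ℕ, g ^ k = 1 ↔ m ∣ k) (hgen : ∀ x, ∃ k : ℕ, x = g ^ k) :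
    ENat.card G = (m : ℕ∞) ∧ Nonempty (G ≃* Multiplicative (ZMod m)) := by
  have hz : ∀ x, x ∈ Subgroup.zpowers g := fun x => by
    obtain ⟨k, rfl⟩ := hgen x
    exact Subgroup.npow_mem_zpowers g k
  have hcard : Nat.card G = m := by
    rw [← orderOf_eq_card_of_forall_mem_zpowers hz]
    exact Nat.dvd_antisymm (orderOf_dvd_of_pow_eq_one ((hg m).2 dvd_rfl))
      ((hg _).1 (pow_orderOf_eq_one g))
  have : Finite G := Nat.finite_of_card_ne_zero (by rwa [hcard])
  refine ⟨by rw [ENat.card_eq_coe_natCard, hcard], ?_⟩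
  subst hcard
  exact ⟨(zmodCyclicMulEquiv ⟨g, hz⟩).symm⟩

/-- It replaces the dependently typed edges by plain triples, which can be compared with data read
off from `σ`. -/
theorem quiverEdge_label_injective (σ : ℝ → ℝ × ℝ) : Function.Injective
    fun e : QuiverEdge σ => (e.left.1, e.right.1, (e.hom.1 : Set (ℝ × ℝ))) := by
  rintro ⟨⟨l, hl⟩, ⟨r, hr⟩, ⟨E, hE⟩⟩ ⟨⟨l', hl'⟩, ⟨r', hr'⟩, ⟨E', hE'⟩⟩ h
  simp only [Prod.mk.injEq] at h
  obtain ⟨rfl, rfl, rfl⟩ := h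
  rfl

/-- The symmetries of a curve whose signature has the minimal period `P = L / m` with respect to
arc length form a cyclic group of rotations of order `m`. -/
theorem IsUnitSpeedClosed.symGroup_eq {z T : ℝ → ℂ} {κ κ' : ℝ → ℝ} {ℓ : ℝ}
    (h : IsUnitSpeedClosed z T κ κ' ℓ) {P : ℝ} (hP : 0 < P) {m : ℕ}
    (hm : m * P = ℓ) (hκ : ∀ s, (κ (s + P), κ' (s + P)) = (κ s, κ' s))
    (hmin : ∀ τ, 0 ≤ τ → (∀ s, (κ (s + τ), κ' (s + τ)) = (κ s, κ' s)) → ∃ q : ℕ, τ = q * P)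
    {Γ : Set Plane} (hΓ : range z = planeToComplex '' Γ) :
    symIndex Γ = (m : ℕ∞) ∧ Nonempty (symGroup Γ ≃* Multiplicative (ZMod m)) ∧
    ∃ C : Plane, ∀ g : SE2, g ∈ symGroup Γ ↔ ∃ k : ℕ, k < m ∧
      ∀ x : Plane, (g : Plane ≃ᵃⁱ[ℝ] Plane) x =
        rotationAbout C (2 * Real.pi * (k : ℝ) / (m : ℝ)) x := by
  obtain ⟨a, C, ha, hsym⟩ := h.exists_primitive_rotation hP hm hκ hmin
  have hm0 : m ≠ 0 := by
    rintro rfl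
    rw [Nat.cast_zero, zero_mul] at hm
    exact h.length_pos.ne hm
  have : NeZero m := ⟨hm0⟩
  set ζ : ℂ := Complex.exp (2 * Real.pi * Complex.I / m) with hζ_def
  have hζ : IsPrimitiveRoot ζ m := Complex.isPrimitiveRoot_exp m hm0
  have hζ1 : ‖ζ‖ = 1 := hζ.norm'_eq_one hm0
  have hmem : ∀ g : SE2, g ∈ symGroup Γ ↔ ∃ k : ℕ, k < m ∧
      ∀ x, planeToComplex ((g : Plane ≃ᵃⁱ[ℝ] Plane) x) = ζ ^ k * (planeToComplex x - C) + C := by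
    intro g
    obtain ⟨u, v, hu, huv⟩ := SE2.exists_eq_mul_add g
    have h1 : g ∈ symGroup Γ ↔ (fun x => u * x + v) '' range z = range z := by
      rw [hΓ, image_image]
      have h2 : (fun x => u * planeToComplex x + v) '' Γ =
          planeToComplex '' ((g : Plane ≃ᵃⁱ[ℝ] Plane) '' Γ) := by
        rw [image_image]
        simp only [huv]
      rw [h2, planeToComplex.injective.image_injective.eq_iff]
      rfl
    rw [h1, hsym u v hu]
    have h3 : ∀ c : ℂ, (∀ x, planeToComplex ((g : Plane ≃ᵃⁱ[ℝ] Plane) x) =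
        c * (planeToComplex x - C) + C) ↔ ∀ x, u * x + v = c * (x - C) + C := by
      intro c
      constructor
      · intro hc x
        have := hc (planeToComplex.symm x)
        rwa [huv, planeToComplex.apply_symm_apply] at this
      · intro hc x
        rw [huv, hc]
    simp only [h3]
    constructor
    -- The generator `a` need not be the rotation by 2π/m, but two primitive m-th roots of unity
    -- have the same powers.
    · rintro ⟨q, hq⟩
      obtain ⟨k, hk, hkq⟩ := hζ.eq_pow_of_pow_eq_one (ξ := a ^ q)
        (by rw [← pow_mul, mul_comm, pow_mul, ha.pow_eq_one, one_pow])
      exact ⟨k, hk, by rwa [hkq]⟩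
    · rintro ⟨k, -, hk⟩
      obtain ⟨q, -, hkq⟩ := ha.eq_pow_of_pow_eq_one (ξ := ζ ^ k)
        (by rw [← pow_mul, mul_comm, pow_mul, hζ.pow_eq_one, one_pow])
      exact ⟨q, by rwa [hkq]⟩
  have hext : ∀ g g' : SE2, (∀ x, planeToComplex ((g : Plane ≃ᵃⁱ[ℝ] Plane) x) =
      planeToComplex ((g' : Plane ≃ᵃⁱ[ℝ] Plane) x)) → g = g' := fun g g' hgg =>
    Subtype.ext (AffineIsometryEquiv.ext fun x => planeToComplex.injective (hgg x))
  obtain ⟨g₁, hg₁⟩ := SE2.exists_of_mul_add hζ1 (C - ζ * C)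
  have hpow : ∀ (k : ℕ) x, planeToComplex (((g₁ ^ k : SE2) : Plane ≃ᵃⁱ[ℝ] Plane) x) =
      ζ ^ k * (planeToComplex x - C) + C := by
    intro k
    induction k with
    | zero =>
      intro x
      simp
    | succ k ih =>
      intro x
      rw [pow_succ']
      change planeToComplex ((g₁ : Plane ≃ᵃⁱ[ℝ] Plane)
        (((g₁ ^ k : SE2) : Plane ≃ᵃⁱ[ℝ] Plane) x)) = _
      rw [hg₁, ih]
      ring
  have hg₁mem : g₁ ∈ symGroup Γ := by
    rw [hmem]
    obtain ⟨k, hk, hkζ⟩ := hζ.eq_pow_of_pow_eq_one hζ.pow_eq_one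
    refine ⟨k, hk, fun x => ?_⟩
    rw [hkζ, hg₁]
    ring
  have hcard := card_and_equiv_zmod_of_generator (g := (⟨g₁, hg₁mem⟩ : symGroup Γ)) hm0
    (fun k => by
      rw [Subtype.ext_iff]
      change g₁ ^ k = 1 ↔ m ∣ k
      rw [← hζ.pow_eq_one_iff_dvd]
      constructor
      · intro hk
        -- At distance 1 from the centre, the image point reads off `ζ ^ k`.
        have h1 := hpow k (planeToComplex.symm (C + 1))
        rw [hk] at h1
        have h2 : C + 1 = ζ ^ k * (C + 1 - C) + C := by
          have h4 : planeToComplex (planeToComplex.symm (C + 1)) = C + 1 :=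
            planeToComplex.apply_symm_apply _
          rw [h4] at h1
          exact h4.symm.trans h1
        linear_combination -h2
      · intro hk
        refine hext _ _ fun x => ?_
        rw [hpow, hk]
        change _ = planeToComplex x
        ring)
    (fun x => by
      obtain ⟨g, hg⟩ := x
      obtain ⟨k, -, hk⟩ := (hmem g).1 hg
      refine ⟨k, Subtype.ext ?_⟩
      change g = g₁ ^ k
      exact hext _ _ fun x => by rw [hk, hpow])
  refine ⟨hcard.1, hcard.2, planeToComplex.symm C, fun g => ?_⟩
  rw [hmem]
  refine exists_congr fun k => and_congr_right fun _ => forall_congr' fun x => ?_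
  rw [← planeToComplex.injective.eq_iff (b := rotationAbout _ _ x), planeToComplex_rotationAbout,
    planeToComplex.apply_symm_apply]
  have hk : Complex.exp (((2 * Real.pi * (k : ℝ) / (m : ℝ) : ℝ) : ℂ) * Complex.I) = ζ ^ k := by
    rw [hζ_def, ← Complex.exp_nat_mul]
    congr 1
    push_cast
    ring
  rw [hk]

/-! ### The symmetry index from the signature quiver. -/

theorem mainTheorem8 (γ : ℝ → Plane) (L : ℝ)
    (hγ : IsSimpleClosed γ L)
    (hnd : IsNondegenerate γ)
    (hfin : (selfIntersections (Set.range (sigMap γ))).Finite)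
    (hne : (selfIntersections (Set.range (sigMap γ))).Nonempty)
    (w : List (QuiverEdge (sigMap γ))) (m : ℕ)
    (hW : InducesWord γ L (wordPow w m))
    (hw : ¬ IsPeriodicWord w) :
    symIndex (Set.range γ) = (m : ℕ∞) ∧
    Nonempty (symGroup (Set.range γ) ≃* Multiplicative (ZMod m)) ∧
    ∃ C : Plane, ∀ g : SE2,
      g ∈ symGroup (Set.range γ) ↔
        ∃ k : ℕ, k < m ∧
          ∀ x : Plane, (g : Plane ≃ᵃⁱ[ℝ] Plane) x =
            rotationAbout C (2 * Real.pi * (k : ℝ) / (m : ℝ)) x := by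
  obtain ⟨S, z, T, κ, κ', ℓ, h, hz, hσS, hSL⟩ := hγ.exists_unitSpeed hnd
  have hΓ : range z = planeToComplex '' range γ := by
    rw [← range_comp, ← S.surjective.range_comp z]
    exact congrArg range (funext hz)
  set σ : ℝ → ℝ × ℝ := fun s => (κ s, κ' s) with hσ
  have hσγ : sigMap γ = σ ∘ S := (funext hσS).symm
  have hrσ : range (sigMap γ) = range σ := by rw [hσγ, S.surjective.range_comp]
  obtain ⟨c, hc, hlast, hrange, hedge⟩ := hW
  set Z : Set ℝ := {s | ¬ IsSimplePoint (range σ) (σ s)} with hZ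
  have hmemZ : ∀ t, t ∈ sigMap γ ⁻¹' selfIntersections (range (sigMap γ)) ↔ S t ∈ Z := by
    intro t
    rw [hrσ, mem_preimage, hσγ]
    exact and_iff_right (mem_range_self (S t))
  -- The identity motion acts as the shift by ℓ.
  have hper : Function.Periodic σ ℓ :=
    h.signature_shift (u := 1) (v := 0) fun s => by rw [h.periodic]; ring
  have hclast : S (c (Fin.last _)) = S (c 0) + ℓ := by rw [hlast, hSL]
  -- A gap between consecutive self-intersection parameters is labelled by the end points and the
  -- image of its edge. The label does not change under the arc length substitution `S`, so the
  -- given word applies to the arc length signature.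
  obtain ⟨P, hP, hmP, hσP, hmin⟩ := exists_minimal_period (σ := σ) (Z := Z) h.length_pos hper
    (fun τ hτ s => by
      change ¬ _ ↔ ¬ _
      rw [hτ]) hw
    (quiverEdge_label_injective (sigMap γ)) (Λ := fun s t => (σ s, σ t, σ '' Ioo s t))
    (fun τ hτ s t => by
      have h1 : σ '' Ioo (s + τ) (t + τ) = σ '' Ioo s t := by
        rw [← image_add_const_Ioo, image_image]
        simp only [hτ]
      rw [hτ, hτ, h1])
    (fun a b a' b' hab _ ha hb ha' hb' hx hx' he =>
      gap_translate h.hasDerivAt_curvature h.continuous_deriv_curvature h.isolated hσ hab ha hb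
        ha' hb' (fun x hxm => not_not.1 (hx x hxm)) (fun x hxm => not_not.1 (hx' x hxm))
        (congrArg (fun p => p.2.2) he))
    (c := fun i => S (c i)) (S.strictMono.comp hc) hclast
    (by
      ext s
      constructor
      · rintro ⟨i, rfl⟩
        obtain ⟨⟨h1, h2⟩, h3⟩ : c i ∈ Icc (c 0) (c 0 + L) ∩ _ := hrange ▸ mem_range_self i
        refine ⟨⟨S.monotone h1, ?_⟩, (hmemZ _).1 h3⟩
        rw [← hSL]
        exact S.monotone h2
      · rintro ⟨⟨h1, h2⟩, h3⟩
        have h4 : S.symm s ∈ range c := by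
          rw [hrange]
          refine ⟨⟨?_, ?_⟩, (hmemZ _).2 (by rwa [S.apply_symm_apply])⟩
          · rwa [S.le_symm_apply]
          · rwa [S.symm_apply_le, hSL]
        obtain ⟨i, hi⟩ := h4
        exact ⟨i, by simp only [hi, S.apply_symm_apply]⟩)
    (fun i => by
      obtain ⟨h1, h2, h3⟩ := hedge i
      have h4 : σ '' Ioo (S (c i.castSucc)) (S (c i.succ)) =
          sigMap γ '' Ioo (c i.castSucc) (c i.succ) := by
        rw [← S.image_Ioo, image_image]
        exact congrArg (fun f : ℝ → ℝ × ℝ => f '' Ioo _ _) hσγ.symm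
      exact Prod.ext (h1.trans (hσS _).symm) (Prod.ext (h2.trans (hσS _).symm) (h3.trans h4.symm)))
  exact h.symGroup_eq hP hmP hσP hmin hΓ
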